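/- Let $\mathcal Z$ be a measurable space (data space) and let $\mathcal W$ be a nonempty standard Borel space (hypothesis space) with a metric $\rho$ that is jointly measurable. Let $L\ge 1$ and $n_1,\dots,n_L\ge 1$ be integers, and put $N_l=\prod_{k=1}^l n_k$. **Hierarchical sampling.** Put $\mathcal M_L=\mathcal Z$ and, for $l<L$, let $\mathcal M_l$ be the measurable space of probability distributions on $\mathcal M_{l+1}$; nodes at depth $l$ take values in $\mathcal M_l$. Let $D\in\mathcal M_0$ be a meta-distribution. Nodes at depth $l$ are indexed by $i_{1:l}=(i_1,\dots,i_l)$ with $1\le i_k\le n_k$. The dataset $\mu$ is the random tree in which the first-layer nodes $\mu_1^{i_1}$ are i.i.d. from $D$ and, given layer $l-1$, the nodes of layer $l$ are independent with $\mu_l^{i_{1:l}}\sim\mu_{l-1}^{i_{1:l-1}}$ for $2\le l\le L$; the leaves $\mu_L^{i_{1:L}}$ are the data points. A learning algorithm is a Markov kernel $P_{W|\mu}$ from trees (of all nodes) to $\mathcal W$. **Generalization error.** Let $\ell:\mathcal W\times\mathcal Z\to\mathbb R$ be a measurable loss such that for some $L_{\mathrm{Lip}}\ge 0$ $$|\ell(w,z)-\ell(w',z)|\le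 L_{\mathrm{Lip}}\,\rho(w,w')\qquad\text{for all } w,w'\in\mathcal W,\ z\in\mathcal Z .$$ Put $$\hat L(w,\mu)=\frac1{N_L}\sum_{i_{1:L}}\ell(w,\mu_L^{i_{1:L}}),\qquad L(w)=\mathbb E_{\mu_L\sim\mu_{L-1}\sim\cdots\sim\mu_1\sim D}[\ell(w,\mu_L)],\qquad \mathrm{gen}=\mathbb E_{\mu,\;W\sim P_{W|\mu}}\bigl[L(W)-\hat L(W,\mu)\bigr],$$ and assume that these expectations exist, i.e. $\ell(w,\mu_L)$ is integrable for every $w\in\mathcal W$, and $L(W)-\hat L(W,\mu)$ is integrable. **Supersample.** Draw, layer after layer, for each node position $i_{1:l}$ a pair $\tilde\mu_l^{i_{1:l}}=(\mu_{l,1}^{i_{1:l}},\mu_{l,2}^{i_{1:l}})$ and a selector $U_l^{i_{1:l}}$ uniform on $\{1,2\}$. The pairs of the first layer are drawn from $D^{\otimes 2}$, and for $2\le l\le L$ the pair at $i_{1:l}$ is drawn from $(\mu_{l-1}^{i_{1:l-1}})^{\otimes2}$, where $\mu_{l}^{i_{1:l}}:=\mu_{l,U_l^{i_{1:l}}}^{i_{1:l}}$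 denotes the selected node. Given the preceding layers, all pairs and selectors of a layer are independent. Finally $W\sim P_{W|\mu}$ is the output of the algorithm on the tree $\mu$ of selected nodes, and $P_{W|\tilde\mu_l^{i_{1:l}},U_l^{i_{1:l}}}$ and $P_{W|\tilde\mu_l^{i_{1:l}}}$ are regular conditional distributions of $W$. **Theorem.** Under these assumptions, $$\mathrm{gen}\;\le\;2L_{\mathrm{Lip}}\sum_{l=1}^{L}\frac1{N_l}\sum_{i_{1:l}}\mathbb E_{\tilde\mu_l^{i_{1:l}},U_l^{i_{1:l}}}\,\mathbb W\!\left(P_{W|\tilde\mu_l^{i_{1:l}},U_l^{i_{1:l}}},\,P_{W|\tilde\mu_l^{i_{1:l}}}\right),$$ where $\mathbb W(P,Q)=\inf_{\pi}\int\rho(x,y)\,d\pi(x,y)\in[0,\infty]$, the infimum being over all couplings $\pi$ of $P$ and $Q$, is the Wasserstein distance of order one for the same metric $\rho$. (The right-hand side may be $+\infty$, with the convention $0\cdot\infty=0$; where the Wasserstein distance is not measurable in the conditioning variables, its expectation is the lower integral.) -/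

import Mathlib

open MeasureTheory ProbabilityTheory
open scoped ENNReal NNReal

namespace HFL

universe u v

/-! ### Wasserstein distance -/

/-- The Wasserstein distance of order one as an optimal transport cost: the infimum over all
couplings `π` of `P` and `Q` of the expected distance under `π`. -/
noncomputable def wasserstein {X : Type v} [MetricSpace X] [MeasurableSpace X]
    (P Q : Measure X) : ℝ≥0∞ :=
  ⨅ π ∈ {π : Measure (X × X) | π.map Prod.fst = P ∧ π.map Prod.snd = Q},
    ∫⁻ p, edist p.1 p.2 ∂π

/-! ### Product kernels -/

/-- Conditionally on `x`, draw the coordinates independently, the `i`-th one from `κ i x`. -/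
noncomputable def piKernel {ι : Type} [Fintype ι] {X : Type u} [MeasurableSpace X]
    {Y : ι → Type u} [∀ i, MeasurableSpace (Y i)] (κ : ∀ i, Kernel X (Y i))
    [∀ i, IsMarkovKernel (κ i)] : Kernel X (∀ i, Y i) where
  toFun x := Measure.pi fun i => κ i x
  measurable' := by
    refine Measurable.measure_of_isPiSystem_of_isProbabilityMeasure
      generateFrom_pi.symm isPiSystem_pi ?_
    rintro _ ⟨s, hs, rfl⟩
    simp only [Measure.pi_pi]
    exact Finset.measurable_prod _ fun i _ =>
      (κ i).measurable_coe (hs i (Set.mem_univ i))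

instance {ι : Type} [Fintype ι] {X : Type u} [MeasurableSpace X]
    {Y : ι → Type u} [∀ i, MeasurableSpace (Y i)] (κ : ∀ i, Kernel X (Y i))
    [∀ i, IsMarkovKernel (κ i)] : IsMarkovKernel (piKernel κ) :=
  ⟨fun x => by
    change IsProbabilityMeasure (Measure.pi fun i => κ i x)
    infer_instance⟩

/-! ### Nodes: iterated spaces of probability distributions -/

/-- The iterated spaces of probability measures over `Z`, with their measurable structures. -/
def tower (Z : Type u) [mZ : MeasurableSpace Z] : ℕ → (X : Type u) × MeasurableSpace X
  | 0 => ⟨Z, mZ⟩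
  | h + 1 =>
    letI : MeasurableSpace (tower Z h).1 := (tower Z h).2
    ⟨ProbabilityMeasure (tower Z h).1, inferInstance⟩

/-- The space of nodes of height `h` above the leaves: `NodeSpace Z 0 = Z`, and
`NodeSpace Z (h + 1)` is the space of probability measures on `NodeSpace Z h`. -/
def NodeSpace (Z : Type u) [MeasurableSpace Z] (h : ℕ) : Type u := (tower Z h).1

instance (Z : Type u) [MeasurableSpace Z] (h : ℕ) : MeasurableSpace (NodeSpace Z h) :=
  (tower Z h).2

/-- Forget that a node of height zero is given in `NodeSpace Z h` with `h = 0`. -/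
def NodeSpace.point {Z : Type u} [MeasurableSpace Z] : ∀ {h : ℕ}, h = 0 → NodeSpace Z h → Z
  | 0, _, z => z

/-- The law of a child of a node: a node of positive height is itself a probability measure
on the nodes one level below, and a child is drawn from it. (At height zero there is nothing
left to sample; the value there, a deterministic copy, plays no role.) -/
noncomputable def nodeKernel (Z : Type u) [MeasurableSpace Z] :
    ∀ h : ℕ, Kernel (NodeSpace Z h) (NodeSpace Z (h - 1))
  | 0 => Kernel.id
  | h + 1 =>
    { toFun := fun (m : ProbabilityMeasure (NodeSpace Z h)) => (m : Measure (NodeSpace Z h))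
      measurable' := measurable_subtype_coe }

instance (Z : Type u) [MeasurableSpace Z] (h : ℕ) : IsMarkovKernel (nodeKernel Z h) := by
  cases h with
  | zero => exact inferInstanceAs (IsMarkovKernel (Kernel.id : Kernel Z Z))
  | succ h => exact ⟨fun m => m.2⟩

/-- The space of nodes at depth `l` of a tree of depth `L`. Data points sit at depth `L`. -/
abbrev Node (Z : Type u) [MeasurableSpace Z] (L l : ℕ) : Type u := NodeSpace Z (L - l)

/-- The data point carried by a leaf. -/
def leafPoint {Z : Type u} [MeasurableSpace Z] {L : ℕ} (x : Node Z L L) : Z :=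
  NodeSpace.point (Nat.sub_self L) x

/-- Sampling a child, at depth `l + 1`, from its parent, at depth `l`. -/
noncomputable def childKernel (Z : Type u) [MeasurableSpace Z] (L l : ℕ) :
    Kernel (Node Z L l) (Node Z L (l + 1)) :=
  nodeKernel Z (L - l)

instance (Z : Type u) [MeasurableSpace Z] (L l : ℕ) : IsMarkovKernel (childKernel Z L l) :=
  inferInstanceAs (IsMarkovKernel (nodeKernel Z (L - l)))

/-! ### Positions in the tree -/

/-- Positions `i_{1:l}` of nodes at depth `l`, where a node at depth `k` has `n (k + 1)`
children. -/
abbrev Pos (n : ℕ → ℕ) (l : ℕ) : Type := (k : Fin l) → Fin (n (k + 1))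

/-- The position `i_{1:l}` of the parent of `i_{1:l+1}`. -/
def Pos.parent {n : ℕ → ℕ} {l : ℕ} (i : Pos n (l + 1)) : Pos n l := fun k => i k.castSucc

/-- The number `N_l = n_1 ⋯ n_l` of nodes at depth `l`. -/
def numNodes (n : ℕ → ℕ) (l : ℕ) : ℕ := ∏ k ∈ Finset.Icc 1 l, n k

/-! ### Hierarchical sampling

`M l` is the space of nodes at depth `l`, `κ l` draws a child from a node at depth `l`, and
`D : M 0` is the root. -/

section Sampling

variable {M : ℕ → Type u} [∀ l, MeasurableSpace (M l)]

/-- The nodes at depth `l`. -/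
abbrev Layer (M : ℕ → Type u) (n : ℕ → ℕ) (l : ℕ) : Type u := Pos n l → M l

/-- The whole tree: all nodes at depths `0, …, L`. -/
abbrev DataTree (M : ℕ → Type u) (n : ℕ → ℕ) (L : ℕ) : Type u :=
  (l : Finset.Iic L) → Layer M n l

/-- The layer `l` of a tree of depth `L`. -/
def DataTree.layer {n : ℕ → ℕ} {L : ℕ} (t : DataTree M n L) (l : ℕ) (hl : l ≤ L) : Layer M n l :=
  t ⟨l, Finset.mem_Iic.2 hl⟩

/-- Given the nodes at depth `l`, each node at depth `l + 1` is drawn from its parent, and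
all of them are drawn independently. -/
noncomputable def layerKernel (κ : ∀ l, Kernel (M l) (M (l + 1))) [∀ l, IsMarkovKernel (κ l)]
    (n : ℕ → ℕ) (l : ℕ) : Kernel (Layer M n l) (Layer M n (l + 1)) :=
  piKernel fun i : Pos n (l + 1) =>
    (κ l).comap (fun t : Layer M n l => t i.parent) (measurable_pi_apply _)

/-- The tree of depth zero that consists of the root `D`. -/
def rootTree (n : ℕ → ℕ) (D : M 0) : DataTree M n 0
  | ⟨0, _⟩ => fun _ => D
  | ⟨_ + 1, h⟩ => absurd (Finset.mem_Iic.1 h) (Nat.not_succ_le_zero _)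

instance (κ : ∀ l, Kernel (M l) (M (l + 1))) [∀ l, IsMarkovKernel (κ l)]
    (n : ℕ → ℕ) (l : ℕ) : IsMarkovKernel (layerKernel κ n l) := by
  unfold layerKernel
  infer_instance

/-- Extending a tree of depth `l` by one layer, which depends only on the last layer. -/
noncomputable def treeStep (κ : ∀ l, Kernel (M l) (M (l + 1))) [∀ l, IsMarkovKernel (κ l)]
    (n : ℕ → ℕ) (l : ℕ) : Kernel (DataTree M n l) (Layer M n (l + 1)) :=
  (layerKernel κ n l).comap (fun t => t.layer l le_rfl) (measurable_pi_apply _)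

instance (κ : ∀ l, Kernel (M l) (M (l + 1))) [∀ l, IsMarkovKernel (κ l)]
    (n : ℕ → ℕ) (l : ℕ) : IsMarkovKernel (treeStep κ n l) :=
  Kernel.IsMarkovKernel.comap _ _

/-- The law of the dataset: the tree is sampled layer after layer, starting from the root. -/
noncomputable def treeLaw (κ : ∀ l, Kernel (M l) (M (l + 1))) [∀ l, IsMarkovKernel (κ l)]
    (n : ℕ → ℕ) (L : ℕ) (D : M 0) : Measure (DataTree M n L) :=
  Kernel.partialTraj (X := Layer M n) (treeStep κ n) 0 L (rootTree n D)

instance (κ : ∀ l, Kernel (M l) (M (l + 1))) [∀ l, IsMarkovKernel (κ l)]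
    (n : ℕ → ℕ) (L : ℕ) (D : M 0) : IsProbabilityMeasure (treeLaw κ n L D) :=
  IsMarkovKernel.isProbabilityMeasure (κ := Kernel.partialTraj (treeStep κ n) 0 L) _

/-- The law of a single node at depth `l`, sampled along the chain
`μ_l ∼ μ_{l-1} ∼ ⋯ ∼ μ_1 ∼ D`. -/
noncomputable def chainLaw (κ : ∀ l, Kernel (M l) (M (l + 1))) (D : M 0) :
    ∀ l : ℕ, Measure (M l)
  | 0 => Measure.dirac D
  | l + 1 => (chainLaw κ D l).bind (κ l)

/-! ### Supersample -/

/-- A supersample at one node: a pair of candidate nodes and a selector. -/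
abbrev Cell (M : ℕ → Type u) (l : ℕ) : Type u := (Fin 2 → M l) × Fin 2

/-- The selected node. -/
def Cell.selected {l : ℕ} (c : Cell M l) : M l := c.1 c.2

lemma Cell.measurable_selected {l : ℕ} :
    Measurable (Cell.selected : Cell M l → M l) :=
  measurable_from_prod_countable_left fun u => measurable_pi_apply u

/-- The supersample at depth `l`. -/
abbrev SuperLayer (M : ℕ → Type u) (n : ℕ → ℕ) (l : ℕ) : Type u := Pos n l → Cell M l

/-- The whole supersample, at depths `0, …, L`. -/
abbrev SuperTree (M : ℕ → Type u) (n : ℕ → ℕ) (L : ℕ) : Type u :=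
  (l : Finset.Iic L) → SuperLayer M n l

/-- The layer `l` of a supersample of depth `L`. -/
def SuperTree.layer {n : ℕ → ℕ} {L : ℕ} (s : SuperTree M n L) (l : ℕ) (hl : l ≤ L) :
    SuperLayer M n l :=
  s ⟨l, Finset.mem_Iic.2 hl⟩

/-- The tree of the selected nodes. -/
def SuperTree.selected {n : ℕ → ℕ} {L : ℕ} (s : SuperTree M n L) : DataTree M n L :=
  fun l i => (s l i).selected

lemma SuperTree.measurable_selected {n : ℕ → ℕ} {L : ℕ} :
    Measurable (SuperTree.selected : SuperTree M n L → DataTree M n L) :=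
  measurable_pi_lambda _ fun l => measurable_pi_lambda _ fun i =>
    Cell.measurable_selected.comp ((measurable_pi_apply i).comp (measurable_pi_apply l))

/-- Given a parent, draw two children independently from it and, independently of them, a
uniform selector. -/
noncomputable def cellKernel (κ : ∀ l, Kernel (M l) (M (l + 1))) [∀ l, IsMarkovKernel (κ l)]
    (l : ℕ) : Kernel (M l) (Cell M (l + 1)) :=
  (piKernel fun _ : Fin 2 => κ l).prod
    (Kernel.const _ (uniformOn (Set.univ : Set (Fin 2))))

instance (κ : ∀ l, Kernel (M l) (M (l + 1))) [∀ l, IsMarkovKernel (κ l)] (l : ℕ) :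
    IsMarkovKernel (cellKernel κ l) := by
  have : IsProbabilityMeasure (uniformOn (Set.univ : Set (Fin 2))) :=
    isProbabilityMeasure_uniformOn Set.finite_univ Set.univ_nonempty
  unfold cellKernel
  infer_instance

/-- Given the supersample at depth `l`, the cells at depth `l + 1` are drawn independently,
each of them from the selected node of the parent cell. -/
noncomputable def superLayerKernel (κ : ∀ l, Kernel (M l) (M (l + 1)))
    [∀ l, IsMarkovKernel (κ l)] (n : ℕ → ℕ) (l : ℕ) :
    Kernel (SuperLayer M n l) (SuperLayer M n (l + 1)) :=
  piKernel fun i : Pos n (l + 1) =>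
    (cellKernel κ l).comap (fun s : SuperLayer M n l => (s i.parent).selected)
      (Cell.measurable_selected.comp (measurable_pi_apply _))

instance (κ : ∀ l, Kernel (M l) (M (l + 1))) [∀ l, IsMarkovKernel (κ l)]
    (n : ℕ → ℕ) (l : ℕ) : IsMarkovKernel (superLayerKernel κ n l) := by
  unfold superLayerKernel
  infer_instance

/-- Extending a supersample of depth `l` by one layer, which depends only on the last layer. -/
noncomputable def superStep (κ : ∀ l, Kernel (M l) (M (l + 1))) [∀ l, IsMarkovKernel (κ l)]
    (n : ℕ → ℕ) (l : ℕ) : Kernel (SuperTree M n l) (SuperLayer M n (l + 1)) :=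
  (superLayerKernel κ n l).comap (fun s => s.layer l le_rfl) (measurable_pi_apply _)

instance (κ : ∀ l, Kernel (M l) (M (l + 1))) [∀ l, IsMarkovKernel (κ l)]
    (n : ℕ → ℕ) (l : ℕ) : IsMarkovKernel (superStep κ n l) :=
  Kernel.IsMarkovKernel.comap _ _

/-- The supersample of depth zero. The root is not resampled: its two candidates both are `D`. -/
def rootSuperTree (n : ℕ → ℕ) (D : M 0) : SuperTree M n 0
  | ⟨0, _⟩ => fun _ => (fun _ => D, 0)
  | ⟨_ + 1, h⟩ => absurd (Finset.mem_Iic.1 h) (Nat.not_succ_le_zero _)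

/-- The law of the supersample, sampled layer after layer. -/
noncomputable def superLaw (κ : ∀ l, Kernel (M l) (M (l + 1))) [∀ l, IsMarkovKernel (κ l)]
    (n : ℕ → ℕ) (L : ℕ) (D : M 0) : Measure (SuperTree M n L) :=
  Kernel.partialTraj (X := SuperLayer M n) (superStep κ n) 0 L (rootSuperTree n D)

instance (κ : ∀ l, Kernel (M l) (M (l + 1))) [∀ l, IsMarkovKernel (κ l)]
    (n : ℕ → ℕ) (L : ℕ) (D : M 0) : IsProbabilityMeasure (superLaw κ n L D) :=
  IsMarkovKernel.isProbabilityMeasure (κ := Kernel.partialTraj (superStep κ n) 0 L) _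

/-! ### Risks and generalization error -/

variable {W : Type v}

/-- The empirical risk of `w`: the average loss over the leaves of the tree. -/
noncomputable def empRisk {n : ℕ → ℕ} {L : ℕ} (loss : W → M L → ℝ) (w : W)
    (t : DataTree M n L) : ℝ :=
  (1 / (numNodes n L : ℝ)) * ∑ i : Pos n L, loss w (t.layer L le_rfl i)

/-- The population risk of `w`: the expected loss at `μ_L ∼ μ_{L-1} ∼ ⋯ ∼ μ_1 ∼ D`. -/
noncomputable def popRisk (κ : ∀ l, Kernel (M l) (M (l + 1))) (D : M 0) {L : ℕ}
    (loss : W → M L → ℝ) (w : W) : ℝ :=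
  ∫ z, loss w z ∂(chainLaw κ D L)

variable [MeasurableSpace W]

/-- The joint law of the dataset and of the hypothesis `W ∼ P_{W|μ}`. -/
noncomputable def dataLaw (κ : ∀ l, Kernel (M l) (M (l + 1))) [∀ l, IsMarkovKernel (κ l)]
    (n : ℕ → ℕ) (L : ℕ) (D : M 0) (A : Kernel (DataTree M n L) W) : Measure (DataTree M n L × W) :=
  (treeLaw κ n L D).compProd A

/-- The generalization error: the expectation of population risk minus empirical risk. -/
noncomputable def genError (κ : ∀ l, Kernel (M l) (M (l + 1))) [∀ l, IsMarkovKernel (κ l)]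
    (n : ℕ → ℕ) (L : ℕ) (D : M 0) (A : Kernel (DataTree M n L) W) (loss : W → M L → ℝ) : ℝ :=
  ∫ p, (popRisk κ D loss p.2 - empRisk loss p.2 p.1) ∂(dataLaw κ n L D A)

/-- The joint law of the supersample and of the hypothesis, the latter being the output of
the algorithm on the tree of selected nodes. -/
noncomputable def jointLaw (κ : ∀ l, Kernel (M l) (M (l + 1))) [∀ l, IsMarkovKernel (κ l)]
    (n : ℕ → ℕ) (L : ℕ) (D : M 0) (A : Kernel (DataTree M n L) W) :
    Measure (SuperTree M n L × W) :=
  (superLaw κ n L D).compProd (A.comap SuperTree.selected SuperTree.measurable_selected)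

instance (κ : ∀ l, Kernel (M l) (M (l + 1))) [∀ l, IsMarkovKernel (κ l)]
    (n : ℕ → ℕ) (L : ℕ) (D : M 0) (A : Kernel (DataTree M n L) W) [IsMarkovKernel A] :
    IsProbabilityMeasure (jointLaw κ n L D A) := by
  unfold jointLaw
  infer_instance

variable [StandardBorelSpace W] [Nonempty W]

/-- The conditional law `P_{W | μ̃_l^i, U_l^i}` given the pair and the selector at the
position `i` of depth `l`. -/
noncomputable def lawGivenCell (κ : ∀ l, Kernel (M l) (M (l + 1))) [∀ l, IsMarkovKernel (κ l)]
    (n : ℕ → ℕ) (L : ℕ) (D : M 0) (A : Kernel (DataTree M n L) W) [IsMarkovKernel A]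
    (l : ℕ) (hl : l ≤ L) (i : Pos n l) : Kernel (Cell M l) W :=
  condDistrib (fun p : SuperTree M n L × W => p.2)
    (fun p : SuperTree M n L × W => p.1.layer l hl i) (jointLaw κ n L D A)

/-- The conditional law `P_{W | μ̃_l^i}` given only the pair at the position `i` of depth
`l`. -/
noncomputable def lawGivenPair (κ : ∀ l, Kernel (M l) (M (l + 1))) [∀ l, IsMarkovKernel (κ l)]
    (n : ℕ → ℕ) (L : ℕ) (D : M 0) (A : Kernel (DataTree M n L) W) [IsMarkovKernel A]
    (l : ℕ) (hl : l ≤ L) (i : Pos n l) : Kernel (Fin 2 → M l) W :=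
  condDistrib (fun p : SuperTree M n L × W => p.2)
    (fun p : SuperTree M n L × W => (p.1.layer l hl i).1) (jointLaw κ n L D A)

end Sampling

/-- The expected Wasserstein distance `E W(P_{W | μ̃_l^i, U_l^i}, P_{W | μ̃_l^i})` at the
position `i` of depth `l`. -/
noncomputable def expectedWasserstein {M : ℕ → Type u} [∀ l, MeasurableSpace (M l)]
    {W : Type v} [MetricSpace W] [MeasurableSpace W] [StandardBorelSpace W] [Nonempty W]
    (κ : ∀ l, Kernel (M l) (M (l + 1))) [∀ l, IsMarkovKernel (κ l)]
    (n : ℕ → ℕ) (L : ℕ) (D : M 0) (A : Kernel (DataTree M n L) W) [IsMarkovKernel A]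
    (l : ℕ) (hl : l ≤ L) (i : Pos n l) : ℝ≥0∞ :=
  ∫⁻ s, wasserstein (lawGivenCell κ n L D A l hl i (s.layer l hl i))
    (lawGivenPair κ n L D A l hl i (s.layer l hl i).1) ∂(superLaw κ n L D)

end HFL

open HFL

/-! Let `nodeLoss` be the expected loss of `w` at a random leaf below a node. At the root it is the
population risk, and averaged over the leaves it is the empirical risk, so the generalization error
telescopes over depths. The contribution of a layer is an average over positions of (value at the
parent) minus (value at the child). The value at the parent is the mean over a fresh child. The
unselected candidate of the cell, the ghost, is such a child: deeper layers and `W` depend only on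
selected nodes, so given the selected tree the ghost is independent of them
(`jointLaw_map_selected_ghost`). The contribution is thus the expectation of `F(W, ghost) - F(W,
selected)`, a function of the cell and `W`. If `W` were drawn from its law given the pair alone,
this would vanish, since flipping the selector changes the sign (`integral_cellGap_kernel_eq_zero`).
The integrand is `2 K`-Lipschitz in `W`, so the easy half of Kantorovich duality bounds the true
value by `2 K` times the expected Wasserstein distance (`ofReal_integral_cellGap_le`). The
individual terms need not be integrable at the random `W`. Everything is therefore multiplied by the
cutoff `k / (k + dist w₀ w)`, after splitting off the loss at a fixed `w₀`. For functions vanishing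
at `w₀` this cutoff does not increase the Lipschitz constant (`abs_cutoff_mul_sub_le`), so the bound
is uniform in `k`. The split-off part tends to zero (`tendsto_centerTerm`), and dominated
convergence recovers the generalization error. -/

namespace HFL

universe u v

/-! ### Trajectories extended by one coordinate -/

section Trajectories

variable {X : ℕ → Type u}

/-- Append one more coordinate to a trajectory. -/
def trajSnoc {L : ℕ} (x : (i : Finset.Iic L) → X i) (y : X (L + 1)) :
    (i : Finset.Iic (L + 1)) → X i :=
  fun i => if h : (i : ℕ) ≤ L then x ⟨i, Finset.mem_Iic.2 h⟩
    else (le_antisymm (Nat.succ_le_of_lt (not_le.1 h)) (Finset.mem_Iic.1 i.2)) ▸ y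

lemma trajSnoc_of_le {L : ℕ} (x : (i : Finset.Iic L) → X i) (y : X (L + 1)) {l : ℕ}
    (h : l ≤ L) (h' : l ∈ Finset.Iic (L + 1)) :
    trajSnoc x y ⟨l, h'⟩ = x ⟨l, Finset.mem_Iic.2 h⟩ :=
  dif_pos h

lemma trajSnoc_last {L : ℕ} (x : (i : Finset.Iic L) → X i) (y : X (L + 1))
    (h' : L + 1 ∈ Finset.Iic (L + 1)) : trajSnoc x y ⟨L + 1, h'⟩ = y :=
  dif_neg (Nat.not_succ_le_self L)

variable [∀ l, MeasurableSpace (X l)]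

lemma measurable_trajSnoc {L : ℕ} :
    Measurable fun p : ((i : Finset.Iic L) → X i) × X (L + 1) => trajSnoc p.1 p.2 := by
  refine measurable_pi_lambda _ fun ⟨l, hl⟩ => ?_
  rcases Nat.lt_or_ge L l with h | h
  · obtain rfl : l = L + 1 := le_antisymm (Finset.mem_Iic.1 hl) h
    simp only [trajSnoc_last]
    exact measurable_snd
  · simp only [trajSnoc_of_le _ _ h]
    exact (measurable_pi_apply _).comp measurable_fst

/-- The recursion behind all inductions on depth. Laws are compared through integrals of nonnegative
functions, so that no integrability has to be carried along. -/
lemma lintegral_partialTraj_succ (κ : ∀ l, Kernel ((i : Finset.Iic l) → X i) (X (l + 1)))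
    [∀ l, IsMarkovKernel (κ l)] (L : ℕ) (x : (i : Finset.Iic 0) → X i)
    {f : ((i : Finset.Iic (L + 1)) → X i) → ℝ≥0∞} (hf : Measurable f) :
    ∫⁻ t, f t ∂Kernel.partialTraj κ 0 (L + 1) x
      = ∫⁻ t, ∫⁻ y, f (trajSnoc t y) ∂κ L t ∂Kernel.partialTraj κ 0 L x := by
  have hm : Measurable (MeasurableEquiv.piSingleton (X := X) L) := MeasurableEquiv.measurable _
  have := Kernel.IsMarkovKernel.map (κ L) hm
  have hg : Measurable fun p => f (IicProdIoc L (L + 1) p) := hf.comp measurable_IicProdIoc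
  rw [Kernel.partialTraj_succ_of_le (Nat.zero_le L),
    Kernel.lintegral_map _ measurable_IicProdIoc _ hf, Kernel.lintegral_comp _ _ _ hg]
  refine lintegral_congr fun t => ?_
  have hgt : Measurable fun y => f (IicProdIoc L (L + 1) (t, y)) := hg.comp measurable_prodMk_left
  rw [Kernel.lintegral_id_prod hg, Kernel.lintegral_map _ hm _ hgt]
  refine lintegral_congr fun y => congrArg f ?_
  funext ⟨l, hl⟩
  rcases Nat.lt_or_ge L l with h | h
  · obtain rfl : l = L + 1 := le_antisymm (Finset.mem_Iic.1 hl) h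
    rw [trajSnoc_last]
    simp [IicProdIoc_def, MeasurableEquiv.piSingleton]
  · rw [trajSnoc_of_le _ _ h]
    simp [IicProdIoc_def, h]

lemma lintegral_partialTraj_restrict
    (κ : ∀ l, Kernel ((i : Finset.Iic l) → X i) (X (l + 1)))
    [∀ l, IsMarkovKernel (κ l)] {l L : ℕ} (h : l ≤ L) (x : (i : Finset.Iic 0) → X i)
    {f : ((i : Finset.Iic l) → X i) → ℝ≥0∞} (hf : Measurable f) :
    ∫⁻ t, f (Preorder.frestrictLe₂ h t) ∂Kernel.partialTraj κ 0 L x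
      = ∫⁻ t, f t ∂Kernel.partialTraj κ 0 l x := by
  rw [← Kernel.partialTraj_map_frestrictLe₂_apply x h, lintegral_map hf (by fun_prop)]

/-- The initial coordinate is never resampled. Test functions are used because equality with the
initial value need not be a measurable event in `X 0`. -/
lemma lintegral_partialTraj_initial
    (κ : ∀ l, Kernel ((i : Finset.Iic l) → X i) (X (l + 1)))
    [∀ l, IsMarkovKernel (κ l)] (L : ℕ) (x : (i : Finset.Iic 0) → X i)
    {f : ((i : Finset.Iic L) → X i) × X 0 → ℝ≥0∞} (hf : Measurable f) :
    ∫⁻ t, f (t, t ⟨0, Finset.mem_Iic.2 (Nat.zero_le L)⟩) ∂Kernel.partialTraj κ 0 L x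
      = ∫⁻ t, f (t, x ⟨0, Finset.mem_Iic.2 le_rfl⟩) ∂Kernel.partialTraj κ 0 L x := by
  have hpair {L : ℕ} {f : ((i : Finset.Iic L) → X i) × X 0 → ℝ≥0∞} (hf : Measurable f) :
      Measurable fun t : (i : Finset.Iic L) → X i =>
        f (t, t ⟨0, Finset.mem_Iic.2 (Nat.zero_le L)⟩) := by fun_prop
  have hconst {L : ℕ} {f : ((i : Finset.Iic L) → X i) × X 0 → ℝ≥0∞} (hf : Measurable f) :
      Measurable fun t : (i : Finset.Iic L) → X i =>
        f (t, x ⟨0, Finset.mem_Iic.2 le_rfl⟩) := hf.comp measurable_prodMk_right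
  induction L with
  | zero =>
    rw [Kernel.partialTraj_self, Kernel.lintegral_id' (hpair hf), Kernel.lintegral_id' (hconst hf)]
  | succ L ih =>
    have hg : Measurable fun p : (((i : Finset.Iic L) → X i) × X 0) × X (L + 1) =>
        f (trajSnoc p.1.1 p.2, p.1.2) :=
      hf.comp ((measurable_trajSnoc.comp
        ((measurable_fst.comp measurable_fst).prodMk measurable_snd)).prodMk
          (measurable_snd.comp measurable_fst))
    -- The initial coordinate stays a free variable `p.2` while the last one is integrated out, so
    -- the induction hypothesis can replace it.
    have key := ih (f := fun p => ∫⁻ y, f (trajSnoc p.1 y, p.2) ∂κ L p.1)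
      (Measurable.lintegral_kernel_prod_right' (κ := (κ L).comap Prod.fst measurable_fst) hg)
    rw [lintegral_partialTraj_succ κ L x (hpair hf),
      lintegral_partialTraj_succ κ L x (hconst hf)]
    simpa only [trajSnoc_of_le _ _ (Nat.zero_le L)] using key

end Trajectories

/-! ### Appending a layer commutes with selection -/

section Snoc

variable {M : ℕ → Type u} {n : ℕ → ℕ}

lemma SuperTree.selected_snoc {L : ℕ} (s : SuperTree M n L) (c : SuperLayer M n (L + 1)) :
    SuperTree.selected (trajSnoc (X := SuperLayer M n) s c)
      = trajSnoc (X := Layer M n) s.selected fun i => (c i).selected := by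
  funext ⟨l, hl⟩ i
  rcases Nat.lt_or_ge L l with h | h
  · obtain rfl : l = L + 1 := le_antisymm (Finset.mem_Iic.1 hl) h
    simp only [SuperTree.selected, trajSnoc_last]
  · simp only [SuperTree.selected, trajSnoc_of_le _ _ h]

lemma SuperTree.layer_snoc_of_le {L : ℕ} (s : SuperTree M n L) (c : SuperLayer M n (L + 1))
    {l : ℕ} (hl : l ≤ L) (hl' : l ≤ L + 1) :
    SuperTree.layer (trajSnoc (X := SuperLayer M n) s c) l hl' = s.layer l hl :=
  trajSnoc_of_le _ _ hl _

lemma SuperTree.layer_snoc_last {L : ℕ} (s : SuperTree M n L) (c : SuperLayer M n (L + 1)) :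
    SuperTree.layer (trajSnoc (X := SuperLayer M n) s c) (L + 1) le_rfl = c :=
  trajSnoc_last _ _ _

lemma DataTree.layer_snoc_of_le {L : ℕ} (t : DataTree M n L) (y : Layer M n (L + 1))
    {l : ℕ} (hl : l ≤ L) (hl' : l ≤ L + 1) :
    DataTree.layer (trajSnoc (X := Layer M n) t y) l hl' = t.layer l hl :=
  trajSnoc_of_le _ _ hl _

lemma DataTree.layer_snoc_last {L : ℕ} (t : DataTree M n L) (y : Layer M n (L + 1)) :
    DataTree.layer (trajSnoc (X := Layer M n) t y) (L + 1) le_rfl = y :=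
  trajSnoc_last _ _ _

end Snoc

/-! ### The ghost candidate as a fresh child -/

section Sampling

variable {M : ℕ → Type u} [∀ l, MeasurableSpace (M l)]

/-- The candidate of a cell that is not selected. -/
def Cell.ghost {l : ℕ} (c : Cell M l) : M l := c.1 (1 - c.2)

lemma Cell.measurable_ghost {l : ℕ} : Measurable (Cell.ghost : Cell M l → M l) :=
  measurable_from_prod_countable_left fun u => measurable_pi_apply (1 - u)

lemma integral_uniformOn_fin_two (f : Fin 2 → ℝ) :
    ∫ u, f u ∂(uniformOn (Set.univ : Set (Fin 2))) = (f 0 + f 1) / 2 := by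
  have : IsProbabilityMeasure (uniformOn (Set.univ : Set (Fin 2))) :=
    isProbabilityMeasure_uniformOn Set.finite_univ Set.univ_nonempty
  have h (u : Fin 2) : (uniformOn (Set.univ : Set (Fin 2))).real {u} = 1 / 2 := by
    simp [Measure.real, uniformOn_univ]
  rw [integral_fintype .of_finite]
  simp [h]
  ring

lemma lintegral_uniformOn_fin_two (f : Fin 2 → ℝ≥0∞) :
    ∫⁻ u, f u ∂(uniformOn (Set.univ : Set (Fin 2))) = f 0 / 2 + f 1 / 2 := by
  simp [lintegral_fintype, uniformOn_univ, div_eq_mul_inv]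

instance : IsProbabilityMeasure (uniformOn (Set.univ : Set (Fin 2))) :=
  isProbabilityMeasure_uniformOn Set.finite_univ Set.univ_nonempty

variable (κ : ∀ l, Kernel (M l) (M (l + 1))) [∀ l, IsMarkovKernel (κ l)]

lemma cellKernel_apply (l : ℕ) (x : M l) :
    cellKernel κ l x
      = (Measure.pi fun _ : Fin 2 => κ l x).prod (uniformOn (Set.univ : Set (Fin 2))) := by
  rw [cellKernel, Kernel.prod_apply, Kernel.const_apply]
  rfl

/-- For either value of the selector, (selected, ghost) is the drawn pair or its swap, and both have
law `κ ⊗ κ`; the mixture over the selector is the same law. -/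
lemma cellKernel_map_selected_ghost (l : ℕ) (x : M l) :
    (cellKernel κ l x).map (fun c => (c.selected, c.ghost)) = (κ l x).prod (κ l x) := by
  have hm : Measurable fun c : Cell M (l + 1) => (c.selected, c.ghost) :=
    Cell.measurable_selected.prodMk Cell.measurable_ghost
  refine Measure.ext_of_lintegral _ fun f hf => ?_
  have hvec := measurePreserving_piFinTwo (fun _ : Fin 2 => κ l x)
  have h0 : ∫⁻ p : Fin 2 → M (l + 1), f (p 0, p 1) ∂Measure.pi (fun _ : Fin 2 => κ l x)
      = ∫⁻ q, f q ∂(κ l x).prod (κ l x) := hvec.lintegral_comp hf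
  have h1 : ∫⁻ p : Fin 2 → M (l + 1), f (p 1, p 0) ∂Measure.pi (fun _ : Fin 2 => κ l x)
      = ∫⁻ q, f q ∂(κ l x).prod (κ l x) :=
    (hvec.lintegral_comp (hf.comp measurable_swap)).trans
      (Measure.measurePreserving_swap.lintegral_comp hf)
  have hg : Measurable fun c : Cell M (l + 1) => f (c.selected, c.ghost) := hf.comp hm
  rw [lintegral_map hf hm, cellKernel_apply, lintegral_prod_symm' _ hg,
    lintegral_uniformOn_fin_two]
  simp only [Cell.selected, Cell.ghost, sub_zero, sub_self, h0, h1]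
  exact ENNReal.add_halves _

variable (n : ℕ → ℕ)

lemma superLayerKernel_map_selected_ghost (l : ℕ) (s : SuperLayer M n l) (j : Pos n (l + 1)) :
    (superLayerKernel κ n l s).map (fun c => (fun i => (c i).selected, (c j).ghost))
      = (layerKernel κ n l fun i => (s i).selected).prod (κ l (s j.parent).selected) := by
  have hm : Measurable fun c : Cell M (l + 1) => (c.selected, c.ghost) :=
    Cell.measurable_selected.prodMk Cell.measurable_ghost
  have hmap : (superLayerKernel κ n l s).map (fun c i => ((c i).selected, (c i).ghost))
      = Measure.pi fun i : Pos n (l + 1) =>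
        (κ l (s i.parent).selected).prod (κ l (s i.parent).selected) := by
    have := Measure.pi_map_pi (μ := fun i : Pos n (l + 1) => cellKernel κ l (s i.parent).selected)
      (f := fun _ c => (c.selected, c.ghost)) fun _ => hm.aemeasurable
    simp only [cellKernel_map_selected_ghost] at this
    exact this
  -- A product of laws of pairs is a pair of product laws: all ghosts together are independent of
  -- all selected nodes. Only the ghost at `j` is then kept.
  have hprod := (measurePreserving_arrowProdEquivProdArrow _ _ _
    (fun i : Pos n (l + 1) => κ l (s i.parent).selected)
    (fun i : Pos n (l + 1) => κ l (s i.parent).selected)).map_eq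
  have heval := (measurePreserving_eval
    (fun i : Pos n (l + 1) => κ l (s i.parent).selected) j).map_eq
  have hm1 : Measurable fun c : SuperLayer M n (l + 1) => fun i =>
      ((c i).selected, (c i).ghost) :=
    measurable_pi_lambda _ fun i => hm.comp (measurable_pi_apply i)
  have hm2 : Measurable (MeasurableEquiv.arrowProdEquivProdArrow (M (l + 1)) (M (l + 1))
    (Pos n (l + 1))) := MeasurableEquiv.measurable _
  have hm3 : Measurable (Prod.map id (Function.eval j) :
      (Layer M n (l + 1)) × (Layer M n (l + 1)) → _) :=
    measurable_id.prodMap (measurable_pi_apply j)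
  have hcomp : (fun c : SuperLayer M n (l + 1) => (fun i => (c i).selected, (c j).ghost))
      = Prod.map id (Function.eval j) ∘ (MeasurableEquiv.arrowProdEquivProdArrow _ _ _) ∘
        (fun c i => ((c i).selected, (c i).ghost)) := rfl
  rw [hcomp, ← Measure.map_map hm3 (hm2.comp hm1), ← Measure.map_map hm2 hm1, hmap, hprod,
    ← Measure.map_prod_map _ _ measurable_id (measurable_pi_apply j), heval, Measure.map_id]
  rfl

lemma superLayerKernel_map_selected (l : ℕ) (s : SuperLayer M n l) :
    (superLayerKernel κ n l s).map (fun c i => (c i).selected)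
      = layerKernel κ n l fun i => (s i).selected := by
  have hcell (x : M l) : (cellKernel κ l x).map Cell.selected = κ l x := by
    have := congrArg (Measure.map Prod.fst) (cellKernel_map_selected_ghost κ l x)
    rw [Measure.map_map measurable_fst
      (Cell.measurable_selected.prodMk Cell.measurable_ghost)] at this
    rwa [Measure.map_fst_prod, measure_univ, one_smul] at this
  have := Measure.pi_map_pi (μ := fun i : Pos n (l + 1) => cellKernel κ l (s i.parent).selected)
    (f := fun _ c => c.selected) fun _ => Cell.measurable_selected.aemeasurable
  simp only [hcell] at this
  exact this

variable {n}

lemma DataTree.measurable_layer {L l : ℕ} (hl : l ≤ L) :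
    Measurable fun t : DataTree M n L => t.layer l hl :=
  measurable_pi_apply _

lemma SuperTree.measurable_layer {L l : ℕ} (hl : l ≤ L) :
    Measurable fun s : SuperTree M n L => s.layer l hl :=
  measurable_pi_apply _

lemma DataTree.measurable_node {L l : ℕ} (hl : l ≤ L) (i : Pos n l) :
    Measurable fun t : DataTree M n L => t.layer l hl i :=
  (measurable_pi_apply i).comp (DataTree.measurable_layer hl)

lemma SuperTree.measurable_cell {L l : ℕ} (hl : l ≤ L) (i : Pos n l) :
    Measurable fun s : SuperTree M n L => s.layer l hl i :=
  (measurable_pi_apply i).comp (SuperTree.measurable_layer hl)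

variable (n) (L : ℕ) (D : M 0)

lemma lintegral_treeLaw_succ {f : DataTree M n (L + 1) → ℝ≥0∞} (hf : Measurable f) :
    ∫⁻ t, f t ∂treeLaw κ n (L + 1) D
      = ∫⁻ t, ∫⁻ y, f (trajSnoc (X := Layer M n) t y) ∂layerKernel κ n L (t.layer L le_rfl)
          ∂treeLaw κ n L D :=
  lintegral_partialTraj_succ (X := Layer M n) (treeStep κ n) L _ hf

lemma lintegral_superLaw_succ {f : SuperTree M n (L + 1) → ℝ≥0∞} (hf : Measurable f) :
    ∫⁻ s, f s ∂superLaw κ n (L + 1) D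
      = ∫⁻ s, ∫⁻ c, f (trajSnoc (X := SuperLayer M n) s c)
          ∂superLayerKernel κ n L (s.layer L le_rfl) ∂superLaw κ n L D :=
  lintegral_partialTraj_succ (X := SuperLayer M n) (superStep κ n) L _ hf

lemma lintegral_superLaw_selected {f : DataTree M n L → ℝ≥0∞} (hf : Measurable f) :
    ∫⁻ s, f s.selected ∂superLaw κ n L D = ∫⁻ t, f t ∂treeLaw κ n L D := by
  induction L with
  | zero =>
    have hroot : (rootSuperTree n D).selected = rootTree n D := by
      funext ⟨l, hl⟩ i
      obtain rfl : l = 0 := Nat.le_zero.1 (Finset.mem_Iic.1 hl)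
      rfl
    have hg : Measurable fun s : SuperTree M n 0 => f s.selected :=
      hf.comp SuperTree.measurable_selected
    rw [superLaw, treeLaw, Kernel.partialTraj_self, Kernel.partialTraj_self,
      Kernel.lintegral_id' hg, Kernel.lintegral_id' hf, hroot]
  | succ L ih =>
    have hg : Measurable fun s : SuperTree M n (L + 1) => f s.selected :=
      hf.comp SuperTree.measurable_selected
    have hsel : Measurable fun c : SuperLayer M n (L + 1) => fun i => (c i).selected :=
      measurable_pi_lambda _ fun i => Cell.measurable_selected.comp (measurable_pi_apply i)
    have hsnoc : Measurable fun p : DataTree M n L × Layer M n (L + 1) =>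
      f (trajSnoc (X := Layer M n) p.1 p.2) := hf.comp measurable_trajSnoc
    rw [lintegral_superLaw_succ κ n L D hg, lintegral_treeLaw_succ κ n L D hf,
      ← ih (f := fun t => ∫⁻ y, f (trajSnoc (X := Layer M n) t y)
        ∂layerKernel κ n L (t.layer L le_rfl))
        (hsnoc.lintegral_kernel_prod_right' (κ := treeStep κ n L))]
    refine lintegral_congr fun s => ?_
    have hft : Measurable fun y => f (trajSnoc (X := Layer M n) s.selected y) :=
      hsnoc.comp measurable_prodMk_left
    simp only [SuperTree.selected_snoc]
    rw [← lintegral_map hft hsel, superLayerKernel_map_selected]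
    rfl

/-- Layers below `l + 1` are drawn from selected nodes only, so they carry no information about the
ghost at `j`: given the whole selected tree, it is still a fresh child of its parent. -/
lemma lintegral_superLaw_selected_ghost {l : ℕ} (hl : l + 1 ≤ L) (j : Pos n (l + 1))
    {f : DataTree M n L × M (l + 1) → ℝ≥0∞} (hf : Measurable f) :
    ∫⁻ s, f (s.selected, (s.layer (l + 1) hl j).ghost) ∂superLaw κ n L D
      = ∫⁻ t, ∫⁻ y, f (t, y) ∂κ l (t.layer l (Nat.le_of_succ_le hl) j.parent)
          ∂treeLaw κ n L D := by
  have hghost {L : ℕ} (hl : l + 1 ≤ L) {f : DataTree M n L × M (l + 1) → ℝ≥0∞}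
      (hf : Measurable f) :
      Measurable fun s : SuperTree M n L => f (s.selected, (s.layer (l + 1) hl j).ghost) :=
    hf.comp (SuperTree.measurable_selected.prodMk
      (Cell.measurable_ghost.comp (SuperTree.measurable_cell hl j)))
  have hchild {L : ℕ} (hl : l ≤ L) {f : DataTree M n L × M (l + 1) → ℝ≥0∞}
      (hf : Measurable f) : Measurable fun t : DataTree M n L =>
        ∫⁻ y, f (t, y) ∂κ l (t.layer l hl j.parent) :=
    hf.lintegral_kernel_prod_right'
      (κ := (κ l).comap (fun t : DataTree M n L => t.layer l hl j.parent)
        (DataTree.measurable_node hl _))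
  induction L, hl using Nat.le_induction with
  | base =>
    have hsnoc : Measurable fun p : (DataTree M n l × Layer M n (l + 1)) × M (l + 1) =>
        f (trajSnoc (X := Layer M n) p.1.1 p.1.2, p.2) :=
      hf.comp ((measurable_trajSnoc.comp measurable_fst).prodMk measurable_snd)
    have hsel : Measurable fun c : SuperLayer M n (l + 1) =>
        (fun i => (c i).selected, (c j).ghost) :=
      (measurable_pi_lambda _ fun i =>
        Cell.measurable_selected.comp (measurable_pi_apply i)).prodMk
          (Cell.measurable_ghost.comp (measurable_pi_apply j))
    have hG : Measurable fun p : DataTree M n l × Layer M n (l + 1) =>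
        ∫⁻ z, f (trajSnoc (X := Layer M n) p.1 p.2, z) ∂κ l (p.1.layer l le_rfl j.parent) :=
      hsnoc.lintegral_kernel_prod_right'
        (κ := (κ l).comap (fun p : DataTree M n l × Layer M n (l + 1) =>
            p.1.layer l le_rfl j.parent)
          ((DataTree.measurable_node le_rfl _).comp measurable_fst))
    rw [lintegral_superLaw_succ κ n l D (hghost le_rfl hf),
      lintegral_treeLaw_succ κ n l D (hchild (Nat.le_succ l) hf)]
    simp only [DataTree.layer_snoc_of_le _ _ le_rfl]
    refine Eq.trans ?_ (lintegral_superLaw_selected κ n l D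
      (hG.lintegral_kernel_prod_right' (κ := treeStep κ n l)))
    refine lintegral_congr fun s => ?_
    have hfs : Measurable fun p : Layer M n (l + 1) × M (l + 1) =>
        f (trajSnoc (X := Layer M n) s.selected p.1, p.2) :=
      hsnoc.comp ((measurable_prodMk_left.comp measurable_fst).prodMk measurable_snd)
    simp only [SuperTree.selected_snoc, SuperTree.layer_snoc_last]
    rw [← lintegral_map (f := fun p => f (trajSnoc (X := Layer M n) s.selected p.1, p.2)) hfs hsel,
      superLayerKernel_map_selected_ghost, lintegral_prod _ hfs.aemeasurable]
    rfl
  | succ L hl ih =>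
    have hsnoc : Measurable fun p : (DataTree M n L × M (l + 1)) × Layer M n (L + 1) =>
        f (trajSnoc (X := Layer M n) p.1.1 p.2, p.1.2) :=
      hf.comp ((measurable_trajSnoc.comp
        ((measurable_fst.comp measurable_fst).prodMk measurable_snd)).prodMk
          (measurable_snd.comp measurable_fst))
    have hsel : Measurable fun c : SuperLayer M n (L + 1) => fun i => (c i).selected :=
      measurable_pi_lambda _ fun i => Cell.measurable_selected.comp (measurable_pi_apply i)
    have hl' : l ≤ L := Nat.le_of_succ_le hl
    have hG : Measurable fun p : DataTree M n L × M (l + 1) =>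
        ∫⁻ y, f (trajSnoc (X := Layer M n) p.1 y, p.2) ∂layerKernel κ n L (p.1.layer L le_rfl) :=
      hsnoc.lintegral_kernel_prod_right'
        (κ := (treeStep κ n L).comap Prod.fst measurable_fst)
    rw [lintegral_superLaw_succ κ n L D (hghost _ hf),
      lintegral_treeLaw_succ κ n L D (hchild _ hf)]
    simp only [DataTree.layer_snoc_of_le _ _ hl', SuperTree.layer_snoc_of_le _ _ hl,
      SuperTree.selected_snoc]
    trans ∫⁻ s, ∫⁻ y, f (trajSnoc (X := Layer M n) s.selected y, (s.layer (l + 1) hl j).ghost)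
        ∂layerKernel κ n L (s.selected.layer L le_rfl) ∂superLaw κ n L D
    · refine lintegral_congr fun s => ?_
      have hfs : Measurable fun y => f (trajSnoc (X := Layer M n) s.selected y,
          (s.layer (l + 1) hl j).ghost) :=
        hsnoc.comp (measurable_prodMk_left (x := (s.selected, (s.layer (l + 1) hl j).ghost)))
      rw [← lintegral_map hfs hsel, superLayerKernel_map_selected]
      rfl
    · rw [ih (f := fun p => ∫⁻ y, f (trajSnoc (X := Layer M n) p.1 y, p.2)
        ∂layerKernel κ n L (p.1.layer L le_rfl)) hG]
      refine lintegral_congr fun t => ?_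
      -- Given the tree up to depth `L`, the ghost and the new layer are independent, and Tonelli
      -- exchanges them.
      refine lintegral_lintegral_swap (μ := κ l (t.layer l hl' j.parent))
        (ν := layerKernel κ n L (t.layer L le_rfl)) (f := fun z y => f (trajSnoc (X := Layer M n) t y, z))
        (Measurable.aemeasurable ?_)
      exact hsnoc.comp ((measurable_prodMk_left.comp measurable_fst).prodMk measurable_snd)

end Sampling

/-! ### Laws of nodes, cells and hypothesis -/

section Laws

variable {M : ℕ → Type u} [∀ l, MeasurableSpace (M l)]
  (κ : ∀ l, Kernel (M l) (M (l + 1))) [∀ l, IsMarkovKernel (κ l)]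
  (n : ℕ → ℕ) (L : ℕ) (D : M 0)

/-- Deeper layers integrate out; then one coordinate of the product over siblings is a single draw
from the parent, as in the chain. -/
lemma treeLaw_map_node {l : ℕ} (hl : l ≤ L) (i : Pos n l) :
    (treeLaw κ n L D).map (fun t => t.layer l hl i) = chainLaw κ D l := by
  refine Measure.ext_of_lintegral _ fun f hf => ?_
  have hm : Measurable fun t : DataTree M n l => f (t.layer l le_rfl i) :=
    hf.comp (DataTree.measurable_node le_rfl i)
  rw [lintegral_map hf (DataTree.measurable_node hl i)]
  refine (lintegral_partialTraj_restrict (X := Layer M n) (treeStep κ n) hl _ hm).trans ?_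
  change ∫⁻ t, f (t.layer l le_rfl i) ∂treeLaw κ n l D = _
  clear hl
  induction l with
  | zero =>
    rw [treeLaw, Kernel.partialTraj_self, Kernel.lintegral_id' hm, chainLaw, lintegral_dirac' _ hf]
    rfl
  | succ l ih =>
    rw [lintegral_treeLaw_succ κ n l D hm, chainLaw,
      Measure.lintegral_bind (κ l).aemeasurable hf.aemeasurable]
    have hg : Measurable fun x => ∫⁻ y, f y ∂κ l x := hf.lintegral_kernel
    rw [← ih i.parent _ hg (hg.comp (DataTree.measurable_node le_rfl _))]
    refine lintegral_congr fun t => ?_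
    simp only [DataTree.layer_snoc_last]
    exact (measurePreserving_eval
      (fun i : Pos n (l + 1) => κ l (t.layer l le_rfl i.parent)) i).lintegral_comp hf

lemma lintegral_superLaw_cell {l : ℕ} (hl : l + 1 ≤ L) (j : Pos n (l + 1))
    {f : Cell M (l + 1) → ℝ≥0∞} (hf : Measurable f) :
    ∫⁻ s, f (s.layer (l + 1) hl j) ∂superLaw κ n L D
      = ∫⁻ s, ∫⁻ c, f c ∂cellKernel κ l (s.layer l le_rfl j.parent).selected
          ∂superLaw κ n l D := by
  have hm : Measurable fun s : SuperTree M n (l + 1) => f (s.layer (l + 1) le_rfl j) :=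
    hf.comp (SuperTree.measurable_cell le_rfl j)
  refine (lintegral_partialTraj_restrict (X := SuperLayer M n) (superStep κ n) hl _ hm).trans ?_
  refine (lintegral_superLaw_succ κ n l D hm).trans ?_
  refine lintegral_congr fun s => ?_
  simp only [SuperTree.layer_snoc_last]
  exact (measurePreserving_eval
    (fun j : Pos n (l + 1) => cellKernel κ l (s.layer l le_rfl j.parent).selected) j).lintegral_comp
      hf

/-- The selector at a node is uniform and independent of the pair. -/
lemma superLaw_map_cell {l : ℕ} (hl : l + 1 ≤ L) (j : Pos n (l + 1)) :
    (superLaw κ n L D).map (fun s => s.layer (l + 1) hl j)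
      = ((superLaw κ n L D).map (fun s => (s.layer (l + 1) hl j).1)).prod
          (uniformOn (Set.univ : Set (Fin 2))) := by
  refine Measure.ext_of_lintegral _ fun f hf => ?_
  have hg : Measurable fun p : Fin 2 → M (l + 1) =>
      ∫⁻ u, f (p, u) ∂uniformOn (Set.univ : Set (Fin 2)) := hf.lintegral_prod_right'
  rw [lintegral_map hf (SuperTree.measurable_cell hl j), lintegral_prod _ hf.aemeasurable,
    lintegral_map hg (SuperTree.measurable_cell hl j).fst, lintegral_superLaw_cell κ n L D hl j hf,
    lintegral_superLaw_cell κ n L D hl j (f := fun c => ∫⁻ u, f (c.1, u)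
      ∂uniformOn (Set.univ : Set (Fin 2))) (hg.comp measurable_fst)]
  refine lintegral_congr fun s => ?_
  have hg' : Measurable fun c : Cell M (l + 1) =>
    ∫⁻ u, f (c.1, u) ∂uniformOn (Set.univ : Set (Fin 2)) := hg.comp measurable_fst
  rw [cellKernel_apply, lintegral_prod _ hf.aemeasurable, lintegral_prod _ hg'.aemeasurable]
  simp only [lintegral_const, measure_univ, mul_one]

variable {W : Type v} [MeasurableSpace W] (A : Kernel (DataTree M n L) W) [IsMarkovKernel A]

instance : IsProbabilityMeasure (dataLaw κ n L D A) := by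
  unfold dataLaw
  infer_instance

/-- `W` sees the supersample only through the selected tree, so given that tree it is independent of
the ghost. This lets a fresh child in an integral be replaced by the ghost. -/
lemma jointLaw_map_selected_ghost {l : ℕ} (hl : l + 1 ≤ L) (j : Pos n (l + 1)) :
    (jointLaw κ n L D A).map
        (fun p => ((p.1.selected, p.2), (p.1.layer (l + 1) hl j).ghost))
      = (dataLaw κ n L D A).compProd
          ((κ l).comap (fun p : DataTree M n L × W => p.1.layer l (Nat.le_of_succ_le hl) j.parent)
            ((DataTree.measurable_node (Nat.le_of_succ_le hl) j.parent).comp measurable_fst)) := by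
  refine Measure.ext_of_lintegral _ fun f hf => ?_
  have hm : Measurable fun p : SuperTree M n L × W =>
      ((p.1.selected, p.2), (p.1.layer (l + 1) hl j).ghost) :=
    ((SuperTree.measurable_selected.comp measurable_fst).prodMk measurable_snd).prodMk
      (Cell.measurable_ghost.comp ((SuperTree.measurable_cell hl j).comp measurable_fst))
  have hf' : Measurable fun p : (DataTree M n L × M (l + 1)) × W => f ((p.1.1, p.2), p.1.2) :=
    hf.comp (((measurable_fst.comp measurable_fst).prodMk measurable_snd).prodMk
      (measurable_snd.comp measurable_fst))
  have hG : Measurable fun p : DataTree M n L × M (l + 1) => ∫⁻ w, f ((p.1, w), p.2) ∂A p.1 :=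
    hf'.lintegral_kernel_prod_right' (κ := A.comap Prod.fst measurable_fst)
  have hfm : Measurable fun p : SuperTree M n L × W =>
    f ((p.1.selected, p.2), (p.1.layer (l + 1) hl j).ghost) := hf.comp hm
  have hin := hf.lintegral_kernel_prod_right'
    (κ := (κ l).comap (fun p : DataTree M n L × W => p.1.layer l (Nat.le_of_succ_le hl) j.parent)
      ((DataTree.measurable_node (Nat.le_of_succ_le hl) j.parent).comp measurable_fst))
  rw [lintegral_map hf hm, jointLaw, dataLaw, Measure.lintegral_compProd hfm,
    Measure.lintegral_compProd hf, Measure.lintegral_compProd hin]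
  refine (lintegral_superLaw_selected_ghost κ n L D hl j hG).trans ?_
  refine lintegral_congr fun t => ?_
  refine lintegral_lintegral_swap (μ := κ l (t.layer l _ j.parent)) (ν := A t)
    (f := fun y w => f ((t, w), y)) (Measurable.aemeasurable ?_)
  exact hf.comp ((measurable_prodMk_left.comp measurable_snd).prodMk measurable_fst)

lemma jointLaw_map_selected :
    (jointLaw κ n L D A).map (fun p => (p.1.selected, p.2)) = dataLaw κ n L D A := by
  refine Measure.ext_of_lintegral _ fun f hf => ?_
  have hm : Measurable fun p : SuperTree M n L × W => (p.1.selected, p.2) :=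
    (SuperTree.measurable_selected.comp measurable_fst).prodMk measurable_snd
  have hfm : Measurable fun p : SuperTree M n L × W => f (p.1.selected, p.2) := hf.comp hm
  rw [lintegral_map hf hm, jointLaw, dataLaw, Measure.lintegral_compProd hfm,
    Measure.lintegral_compProd hf]
  exact lintegral_superLaw_selected κ n L D (hf.lintegral_kernel_prod_right' (κ := A))

/-- Needed because the loss at the root is identified with the population risk only at the point
`D`. -/
lemma dataLaw_map_root (i : Pos n 0) :
    (dataLaw κ n L D A).map (fun p => (p.2, p.1.layer 0 (Nat.zero_le L) i))
      = (dataLaw κ n L D A).map (fun p => (p.2, D)) := by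
  refine Measure.ext_of_lintegral _ fun f hf => ?_
  have hm : Measurable fun p : DataTree M n L × W => (p.2, p.1.layer 0 (Nat.zero_le L) i) :=
    measurable_snd.prodMk ((DataTree.measurable_node (Nat.zero_le L) i).comp measurable_fst)
  have hm' : Measurable fun p : DataTree M n L × W => (p.2, D) :=
    measurable_snd.prodMk measurable_const
  have hfm : Measurable fun p : DataTree M n L × W =>
    f (p.2, p.1.layer 0 (Nat.zero_le L) i) := hf.comp hm
  have hfm' : Measurable fun p : DataTree M n L × W => f (p.2, D) := hf.comp hm'
  rw [lintegral_map hf hm, lintegral_map hf hm', dataLaw, Measure.lintegral_compProd hfm,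
    Measure.lintegral_compProd hfm']
  have hG : Measurable fun p : (DataTree M n L × Layer M n 0) × W => f (p.2, p.1.2 i) :=
    hf.comp (measurable_snd.prodMk
      ((measurable_pi_apply i).comp (measurable_snd.comp measurable_fst)))
  exact lintegral_partialTraj_initial (X := Layer M n) (treeStep κ n) L (rootTree n D)
    (hG.lintegral_kernel_prod_right' (κ := A.comap Prod.fst measurable_fst))

end Laws

/-! ### Wasserstein lower bound and Lipschitz cutoffs -/

section Analysis

lemma ofReal_integral_le_lintegral_ofReal {α : Type*} [MeasurableSpace α] (μ : Measure α)
    (g : α → ℝ) : ENNReal.ofReal (∫ x, g x ∂μ) ≤ ∫⁻ x, ENNReal.ofReal (g x) ∂μ := by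
  by_cases hg : Integrable g μ
  · rw [integral_eq_lintegral_pos_part_sub_lintegral_neg_part hg]
    exact (ENNReal.ofReal_le_ofReal (sub_le_self _ ENNReal.toReal_nonneg)).trans
      ENNReal.ofReal_toReal_le
  · simp [integral_undef hg]

/-- Since `g - g'` is bounded, `g` and `g'` are integrable together. Otherwise both integrals have
the default value zero, and `C ≥ 0` as the space is nonempty. -/
lemma abs_integral_sub_integral_le {α : Type*} [MeasurableSpace α] (μ : Measure α)
    [IsProbabilityMeasure μ] {g g' : α → ℝ} (hg : Measurable g) (hg' : Measurable g') {C : ℝ}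
    (h : ∀ x, |g x - g' x| ≤ C) : |∫ x, g x ∂μ - ∫ x, g' x ∂μ| ≤ C := by
  have hd : Integrable (fun x => g x - g' x) μ :=
    .of_bound (hg.sub hg').aestronglyMeasurable C (.of_forall (p := fun x => |g x - g' x| ≤ C) h)
  by_cases hi : Integrable g μ
  · have hi' : Integrable g' μ := (hi.sub hd).congr (.of_forall fun x => sub_sub_cancel _ _)
    rw [← integral_sub hi hi']
    simpa using norm_integral_le_of_norm_le_const (μ := μ) (f := fun x => g x - g' x) (.of_forall h)
  · have hi' : ¬ Integrable g' μ := fun hi' =>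
      hi ((hi'.add hd).congr (.of_forall fun x => add_sub_cancel _ _))
    obtain ⟨x⟩ := μ.nonempty_of_neZero
    rw [integral_undef hi, integral_undef hi', sub_zero, abs_zero]
    exact (abs_nonneg _).trans (h x)

variable {W : Type v} [MetricSpace W]

/-- The easy half of Kantorovich duality. -/
lemma ofReal_integral_sub_le_wasserstein [MeasurableSpace W] (P Q : Measure W)
    [IsProbabilityMeasure P] [IsProbabilityMeasure Q] {f : W → ℝ} (hf : Measurable f) {B : ℝ}
    (hB : ∀ w, |f w| ≤ B) {K : ℝ≥0} (hK : ∀ w w', |f w - f w'| ≤ K * dist w w') :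
    ENNReal.ofReal (∫ w, f w ∂P - ∫ w, f w ∂Q) ≤ K * wasserstein P Q := by
  -- For `K = 0` the right side is zero even at infinite distance, so `f` has to be seen to be
  -- constant. For `K ≠ 0`, dividing by `K` reduces the claim to a bound for each coupling.
  rcases eq_or_ne K 0 with rfl | hK0
  · obtain ⟨w₀⟩ := P.nonempty_of_neZero
    have hc (w : W) : f w = f w₀ := by
      have := hK w w₀
      simp only [NNReal.coe_zero, zero_mul, abs_nonpos_iff] at this
      exact sub_eq_zero.1 this
    simp [hc]
  rw [← ENNReal.div_le_iff' (by simpa using hK0) ENNReal.coe_ne_top]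
  refine le_iInf₂ fun π hπ => ?_
  obtain ⟨h1, h2⟩ := hπ
  rw [ENNReal.div_le_iff' (by simpa using hK0) ENNReal.coe_ne_top]
  have hπ : IsProbabilityMeasure π := by
    constructor
    rw [← Set.preimage_univ (f := Prod.fst), ← Measure.map_apply measurable_fst .univ, h1,
      measure_univ]
  have hint {g : W × W → W} (hg : Measurable g) : Integrable (fun p => f (g p)) π :=
    .of_bound (hf.comp hg).aestronglyMeasurable B (.of_forall fun p => hB (g p))
  rw [← h1, ← h2, integral_map measurable_fst.aemeasurable hf.aestronglyMeasurable,
    integral_map measurable_snd.aemeasurable hf.aestronglyMeasurable,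
    ← integral_sub (hint measurable_fst) (hint measurable_snd),
    ← lintegral_const_mul' _ _ ENNReal.coe_ne_top]
  refine (ofReal_integral_le_lintegral_ofReal _ _).trans (lintegral_mono fun p => ?_)
  refine (ENNReal.ofReal_le_ofReal ((le_abs_self _).trans (hK p.1 p.2))).trans_eq ?_
  rw [ENNReal.ofReal_mul K.coe_nonneg, edist_dist, ENNReal.ofReal_coe_nnreal]

/-- A cutoff around `w₀` at scale `k`. -/
noncomputable def cutoff (k : ℝ) (w₀ w : W) : ℝ := k / (k + dist w₀ w)

lemma cutoff_nonneg {k : ℝ} (hk : 0 < k) (w₀ w : W) : 0 ≤ cutoff k w₀ w :=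
  div_nonneg hk.le (add_nonneg hk.le dist_nonneg)

lemma cutoff_le_one {k : ℝ} (hk : 0 < k) (w₀ w : W) : cutoff k w₀ w ≤ 1 :=
  div_le_one_of_le₀ (le_add_of_nonneg_right dist_nonneg) (add_nonneg hk.le dist_nonneg)

lemma abs_cutoff_mul_le {k : ℝ} (hk : 0 < k) (w₀ w : W) (x : ℝ) :
    |cutoff k w₀ w * x| ≤ |x| := by
  rw [abs_mul, abs_of_nonneg (cutoff_nonneg hk w₀ w)]
  exact mul_le_of_le_one_left (abs_nonneg x) (cutoff_le_one hk w₀ w)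

lemma cutoff_mul_dist_le {k : ℝ} (hk : 0 < k) (w₀ w : W) : cutoff k w₀ w * dist w₀ w ≤ k := by
  have h : 0 < k + dist w₀ w := add_pos_of_pos_of_nonneg hk dist_nonneg
  rw [cutoff, div_mul_eq_mul_div, div_le_iff₀ h]
  nlinarith

lemma tendsto_cutoff (w₀ w : W) :
    Filter.Tendsto (fun k : ℕ => cutoff ((k : ℝ) + 1) w₀ w) .atTop (nhds 1) := by
  have h : Filter.Tendsto (fun k : ℕ => 1 - dist w₀ w / (((k : ℝ) + 1) + dist w₀ w)) .atTop
      (nhds (1 - 0)) :=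
    tendsto_const_nhds.sub (tendsto_const_nhds.div_atTop
      (Filter.tendsto_atTop_add_const_right _ _
        (Filter.tendsto_atTop_add_const_right _ _ tendsto_natCast_atTop_atTop)))
  rw [sub_zero] at h
  refine h.congr fun k => ?_
  have : 0 < ((k : ℝ) + 1) + dist w₀ w := by positivity
  rw [cutoff, eq_div_iff this.ne', sub_mul, div_mul_cancel₀ _ this.ne']
  ring

lemma measurable_cutoff [MeasurableSpace W] (hdist : Measurable fun p : W × W => dist p.1 p.2)
    (k : ℝ) (w₀ : W) : Measurable (cutoff k w₀) :=
  measurable_const.div (measurable_const.add (hdist.comp measurable_prodMk_left))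

/-- Multiplication by the cutoff preserves the Lipschitz constant of a function vanishing at the
center. -/
lemma abs_cutoff_mul_sub_le {k : ℝ} (hk : 0 < k) {w₀ : W} {h : W → ℝ} {K : ℝ} (hK0 : 0 ≤ K)
    (hK : ∀ w w', |h w - h w'| ≤ K * dist w w') (h0 : h w₀ = 0) (w w' : W) :
    |cutoff k w₀ w * h w - cutoff k w₀ w' * h w'| ≤ K * dist w w' := by
  -- With `w'` the point closer to the center, the difference of cutoffs has a known sign and
  -- multiplies the smaller bound `K * r'` on `|h w'|`.
  wlog hle : dist w₀ w' ≤ dist w₀ w generalizing w w'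
  · rw [abs_sub_comm, dist_comm]
    exact this w' w (le_of_not_ge hle)
  have hw' : |h w'| ≤ K * dist w₀ w' := by simpa [h0, dist_comm] using hK w' w₀
  have htri : dist w₀ w - dist w₀ w' ≤ dist w w' := by
    linarith [dist_triangle w₀ w' w, dist_comm w w']
  have hr' : 0 ≤ dist w₀ w' := dist_nonneg
  have hd : 0 ≤ dist w w' := dist_nonneg
  unfold cutoff
  set r := dist w₀ w
  set r' := dist w₀ w'
  have hkr : 0 < k + r := by linarith
  have hkr' : 0 < k + r' := by linarith
  have e : k / (k + r) * h w - k / (k + r') * h w'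
      = k / (k + r) * (h w - h w') - k * (r - r') / ((k + r) * (k + r')) * h w' := by
    field_simp
    ring
  have c1 : 0 ≤ k / (k + r) := (div_pos hk hkr).le
  have c2 : 0 ≤ k * (r - r') / ((k + r) * (k + r')) :=
    div_nonneg (mul_nonneg hk.le (by linarith)) (mul_pos hkr hkr').le
  calc |k / (k + r) * h w - k / (k + r') * h w'|
      ≤ k / (k + r) * |h w - h w'| + k * (r - r') / ((k + r) * (k + r')) * |h w'| := by
        rw [e]
        refine (abs_sub _ _).trans_eq ?_
        rw [abs_mul, abs_mul, abs_of_nonneg c1, abs_of_nonneg c2]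
    _ ≤ k / (k + r) * (K * dist w w')
        + k * dist w w' / ((k + r) * (k + r')) * (K * r') := by
        gcongr
        exact hK w w'
    _ = K * dist w w' * ((k * (k + r') + k * r') / ((k + r) * (k + r'))) := by
        field_simp
    _ ≤ K * dist w w' * 1 := by
        gcongr
        rw [div_le_one (mul_pos hkr hkr')]
        -- The claim is `k (k + 2 r') ≤ (k + r) (k + r')`, which follows from `r' ≤ r`.
        nlinarith
    _ = K * dist w w' := mul_one _

/-- A Lipschitz function grows at most linearly in the distance to `w₀`, and the cutoff times that
distance is at most `k`. Hence no moment assumption on `W` is needed. -/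
lemma abs_cutoff_mul_le_of_lipschitz {k : ℝ} (hk : 0 < k) {w₀ : W} {h : W → ℝ} {K : ℝ}
    (hK0 : 0 ≤ K) (hK : ∀ w w', |h w - h w'| ≤ K * dist w w') (w : W) :
    |cutoff k w₀ w * h w| ≤ |h w₀| + K * k := by
  have h1 : |h w| ≤ |h w₀| + K * dist w₀ w := by
    have := hK w w₀
    rw [dist_comm] at this
    linarith [abs_sub_abs_le_abs_sub (h w) (h w₀)]
  have c0 := cutoff_nonneg hk w₀ w
  rw [abs_mul, abs_of_nonneg c0]
  calc cutoff k w₀ w * |h w| ≤ cutoff k w₀ w * (|h w₀| + K * dist w₀ w) := by gcongr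
    _ = cutoff k w₀ w * |h w₀| + K * (cutoff k w₀ w * dist w₀ w) := by ring
    _ ≤ |h w₀| + K * k := by
      gcongr
      · exact mul_le_of_le_one_left (abs_nonneg _) (cutoff_le_one hk w₀ w)
      · exact cutoff_mul_dist_le hk w₀ w

end Analysis

/-! ### Expected loss below a node -/

section NodeLoss

variable {M : ℕ → Type u} [∀ l, MeasurableSpace (M l)]
  (κ : ∀ l, Kernel (M l) (M (l + 1)))
  {W : Type v} {L : ℕ} (f : W → M L → ℝ)

/-- The expectation of `f` after `k` further samplings from a node at depth `l`; the value is
zero unless `l + k = L`. -/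
noncomputable def iteratedLoss : ∀ k l : ℕ, W → M l → ℝ
  | 0, l => fun w x => if h : l = L then f w (h ▸ x) else 0
  | k + 1, l => fun w x => ∫ y, iteratedLoss k (l + 1) w y ∂κ l x

/-- The expected loss of `w` at a leaf below a node at depth `l`. -/
noncomputable def nodeLoss (l : ℕ) : W → M l → ℝ := iteratedLoss κ f (L - l) l

lemma nodeLoss_self : nodeLoss κ f L = f := by
  funext w x
  simp [nodeLoss, iteratedLoss]

lemma nodeLoss_of_lt {l : ℕ} (hl : l < L) (w : W) (x : M l) :
    nodeLoss κ f l w x = ∫ y, nodeLoss κ f (l + 1) w y ∂κ l x := by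
  have : L - l = (L - (l + 1)) + 1 := by omega
  rw [nodeLoss, this, iteratedLoss]
  rfl

variable {κ f} [∀ l, IsMarkovKernel (κ l)] [MeasurableSpace W]

lemma measurable_nodeLoss (hf : Measurable fun p : W × M L => f p.1 p.2) (l : ℕ) :
    Measurable fun p : W × M l => nodeLoss κ f l p.1 p.2 := by
  unfold nodeLoss
  generalize L - l = k
  induction k generalizing l with
  | zero =>
    by_cases h : l = L
    · subst h
      simpa [iteratedLoss] using hf
    · simp [iteratedLoss, h]
  | succ k ih =>
    have hm : Measurable fun q : (W × M l) × M (l + 1) => iteratedLoss κ f k (l + 1) q.1.1 q.2 :=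
      (ih (l + 1)).comp ((measurable_fst.comp measurable_fst).prodMk measurable_snd)
    exact (StronglyMeasurable.integral_kernel_prod_right'
      (κ := (κ l).comap (Prod.snd : W × M l → M l) measurable_snd)
      hm.stronglyMeasurable).measurable

/-- Averaging keeps the Lipschitz constant. This holds at every node, including exceptional ones
where the integrals take the default value zero. -/
lemma abs_nodeLoss_sub_le [MetricSpace W] (hf : Measurable fun p : W × M L => f p.1 p.2) {K : ℝ≥0}
    (hK : ∀ w w' x, |f w x - f w' x| ≤ K * dist w w') {l : ℕ} (hl : l ≤ L) (w w' : W) (x : M l) :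
    |nodeLoss κ f l w x - nodeLoss κ f l w' x| ≤ K * dist w w' := by
  induction hl using Nat.decreasingInduction with
  | self => simpa only [nodeLoss_self] using hK w w' x
  | of_succ l hl ih =>
    rw [nodeLoss_of_lt κ f hl, nodeLoss_of_lt κ f hl]
    exact abs_integral_sub_integral_le _
      ((measurable_nodeLoss hf (l + 1)).comp measurable_prodMk_left)
      ((measurable_nodeLoss hf (l + 1)).comp measurable_prodMk_left) ih

instance (D : M 0) (l : ℕ) : IsProbabilityMeasure (chainLaw κ D l) := by
  induction l with
  | zero => exact Measure.dirac.isProbabilityMeasure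
  | succ l ih =>
    rw [chainLaw]
    infer_instance

/-- The tower property, descending from the leaves; integrability at depth `l + 1` passes to the
conditional expectation at depth `l`. -/
lemma integrable_nodeLoss_and_integral_eq (hf : Measurable fun p : W × M L => f p.1 p.2)
    {D : M 0} {w : W} (hw : Integrable (f w) (chainLaw κ D L)) {l : ℕ} (hl : l ≤ L) :
    Integrable (nodeLoss κ f l w) (chainLaw κ D l) ∧
      ∫ x, nodeLoss κ f l w x ∂chainLaw κ D l = popRisk κ D f w := by
  induction hl using Nat.decreasingInduction with
  | self => simpa only [nodeLoss_self] using ⟨hw, rfl⟩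
  | of_succ l hl ih =>
    have e : nodeLoss κ f l w = fun x => ∫ y, nodeLoss κ f (l + 1) w y ∂κ l x :=
      funext fun x => nodeLoss_of_lt κ f hl w x
    have hi : Integrable (fun p => nodeLoss κ f (l + 1) w p.2) ((chainLaw κ D l).compProd (κ l)) :=
      (Measure.integrable_compProd_snd_iff ih.1.1).2 ih.1
    rw [e, ← ih.2]
    have hi' := Integrable.integral_compProd (κ := Kernel.const Unit (chainLaw κ D l))
      (η := Kernel.prodMkLeft Unit (κ l)) (a := ()) hi
    refine ⟨by simpa using hi', ?_⟩
    have hm : AEStronglyMeasurable (nodeLoss κ f (l + 1) w) ((chainLaw κ D l).compProd (κ l)).snd :=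
      ((measurable_nodeLoss hf (l + 1)).comp measurable_prodMk_left).aestronglyMeasurable
    rw [← Measure.integral_compProd hi, chainLaw, ← Measure.snd_compProd]
    exact (integral_map measurable_snd.aemeasurable hm).symm

/-- The chain law at depth zero is the Dirac mass at `D`, so the integrated identity is an identity
at the point `D`. -/
lemma nodeLoss_zero (hf : Measurable fun p : W × M L => f p.1 p.2)
    {D : M 0} {w : W} (hw : Integrable (f w) (chainLaw κ D L)) :
    nodeLoss κ f 0 w D = popRisk κ D f w := by
  have h := (integrable_nodeLoss_and_integral_eq hf hw (Nat.zero_le L)).2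
  have hm : Measurable (nodeLoss κ f 0 w) :=
    (measurable_nodeLoss hf 0).comp measurable_prodMk_left
  rwa [chainLaw, integral_dirac' _ _ hm.stronglyMeasurable] at h

end NodeLoss

/-! ### Truncated loss gap of a cell -/

section CellGap

variable {M : ℕ → Type u} {W : Type v} [MetricSpace W] {l : ℕ} {F : W → M (l + 1) → ℝ} {w₀ : W}
  {K : ℝ≥0}

/-- The truncated difference of the losses at the two candidates of a cell, relative to its value
at `w₀`. -/
noncomputable def cellGap (F : W → M (l + 1) → ℝ) (w₀ : W) (k : ℝ) (c : Cell M (l + 1)) (w : W) :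
    ℝ :=
  cutoff k w₀ w * ((F w c.ghost - F w c.selected) - (F w₀ c.ghost - F w₀ c.selected))

/-- Ghost and selected loss are each `K`-Lipschitz; their difference is the source of the factor 2.
Subtracting the value at `w₀` makes the cutoff harmless. -/
lemma abs_cellGap_sub_le (hK : ∀ w w' x, |F w x - F w' x| ≤ K * dist w w') {k : ℝ} (hk : 0 < k)
    (c : Cell M (l + 1)) (w w' : W) :
    |cellGap F w₀ k c w - cellGap F w₀ k c w'| ≤ ((2 * K : ℝ≥0) : ℝ) * dist w w' := by
  refine abs_cutoff_mul_sub_le hk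
    (h := fun w => (F w c.ghost - F w c.selected) - (F w₀ c.ghost - F w₀ c.selected))
    (NNReal.coe_nonneg _) (fun w w' => ?_) (by ring) w w'
  have h1 := abs_le.1 (hK w w' c.ghost)
  have h2 := abs_le.1 (hK w w' c.selected)
  push_cast
  rw [abs_le]
  constructor <;> linarith [h1.1, h1.2, h2.1, h2.2]

lemma abs_cellGap_le (hK : ∀ w w' x, |F w x - F w' x| ≤ K * dist w w') {k : ℝ} (hk : 0 < k)
    (c : Cell M (l + 1)) (w : W) :
    |cellGap F w₀ k c w| ≤ ((2 * K : ℝ≥0) : ℝ) * k := by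
  have h := abs_cutoff_mul_le_of_lipschitz (w₀ := w₀) hk (K := ((2 * K : ℝ≥0) : ℝ))
    (h := fun w => (F w c.ghost - F w c.selected) - (F w₀ c.ghost - F w₀ c.selected))
    (NNReal.coe_nonneg _) (fun w w' => ?_) w
  · simpa [cellGap] using h
  have h1 := abs_le.1 (hK w w' c.ghost)
  have h2 := abs_le.1 (hK w w' c.selected)
  push_cast
  rw [abs_le]
  constructor <;> linarith [h1.1, h1.2, h2.1, h2.2]

variable [∀ l, MeasurableSpace (M l)] [MeasurableSpace W]

lemma measurable_cellGap (hdist : Measurable fun p : W × W => dist p.1 p.2)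
    (hF : Measurable fun p : W × M (l + 1) => F p.1 p.2) (k : ℝ) :
    Measurable fun p : Cell M (l + 1) × W => cellGap F w₀ k p.1 p.2 := by
  have hg : Measurable fun p : Cell M (l + 1) × W => p.1.ghost :=
    Cell.measurable_ghost.comp measurable_fst
  have hs : Measurable fun p : Cell M (l + 1) × W => p.1.selected :=
    Cell.measurable_selected.comp measurable_fst
  exact ((measurable_cutoff hdist k w₀).comp measurable_snd).mul
    (((hF.comp (measurable_snd.prodMk hg)).sub (hF.comp (measurable_snd.prodMk hs))).sub
      ((hF.comp (measurable_const.prodMk hg)).sub (hF.comp (measurable_const.prodMk hs))))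

/-- Only the law of `Y` and the loss at `w₀` matter: the dependence between `V` and `Y` is
arbitrary. -/
lemma integrable_cutoff_mul {Ω : Type*} [MeasurableSpace Ω] {P : Measure Ω} [IsFiniteMeasure P]
    {X : Type*} [MeasurableSpace X] {f : W → X → ℝ} {ν : Measure X}
    (hdist : Measurable fun p : W × W => dist p.1 p.2)
    (hf : Measurable fun p : W × X => f p.1 p.2)
    (hK : ∀ w w' x, |f w x - f w' x| ≤ K * dist w w') (hint : Integrable (f w₀) ν)
    {k : ℝ} (hk : 0 < k) {V : Ω → W} {Y : Ω → X} (hV : Measurable V) (hY : Measurable Y)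
    (hlaw : P.map Y = ν) :
    Integrable (fun a => cutoff k w₀ (V a) * f (V a) (Y a)) P := by
  subst hlaw
  have h1 : Integrable (fun a => |f w₀ (Y a)| + K * k) P :=
    ((hint.comp_measurable hY).abs).add (integrable_const _)
  refine h1.mono' ?_ (.of_forall fun a => ?_)
  · exact (((measurable_cutoff hdist k w₀).comp hV).mul
      (hf.comp (hV.prodMk hY))).aestronglyMeasurable
  · exact abs_cutoff_mul_le_of_lipschitz hk K.coe_nonneg (fun w w' => hK w w' (Y a)) (V a)

end CellGap

/-! ### Contribution of one layer -/

section LayerStep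

variable {M : ℕ → Type u} [∀ l, MeasurableSpace (M l)]
  (κ : ∀ l, Kernel (M l) (M (l + 1))) [∀ l, IsMarkovKernel (κ l)]
  (n : ℕ → ℕ) (L : ℕ) (D : M 0)

section MarginalLaws

variable {W : Type v} [MeasurableSpace W] (A : Kernel (DataTree M n L) W) [IsMarkovKernel A]

lemma dataLaw_map_node {l : ℕ} (hl : l ≤ L) (i : Pos n l) :
    (dataLaw κ n L D A).map (fun p => p.1.layer l hl i) = chainLaw κ D l := by
  have h : (dataLaw κ n L D A).map Prod.fst = treeLaw κ n L D := Measure.fst_compProd _ _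
  rw [← treeLaw_map_node κ n L D hl i, ← h,
    Measure.map_map (DataTree.measurable_node hl i) measurable_fst]
  rfl

lemma jointLaw_map_cell {l : ℕ} (hl : l ≤ L) (j : Pos n l) :
    (jointLaw κ n L D A).map (fun p => p.1.layer l hl j)
      = (superLaw κ n L D).map (fun s => s.layer l hl j) := by
  have h : (jointLaw κ n L D A).map Prod.fst = superLaw κ n L D := Measure.fst_compProd _ _
  rw [← h, Measure.map_map (SuperTree.measurable_cell hl j) measurable_fst]
  rfl

lemma jointLaw_map_selected_node {l : ℕ} (hl : l ≤ L) (j : Pos n l) :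
    (jointLaw κ n L D A).map (fun p => (p.1.layer l hl j).selected) = chainLaw κ D l := by
  have hm : Measurable fun p : SuperTree M n L × W => (p.1.selected, p.2) :=
    (SuperTree.measurable_selected.comp measurable_fst).prodMk measurable_snd
  have hnode : Measurable fun p : DataTree M n L × W => p.1.layer l hl j :=
    (DataTree.measurable_node hl j).comp measurable_fst
  rw [← dataLaw_map_node κ n L D A hl j, ← jointLaw_map_selected, Measure.map_map hnode hm]
  rfl

lemma jointLaw_map_ghost {l : ℕ} (hl : l + 1 ≤ L) (j : Pos n (l + 1)) :
    (jointLaw κ n L D A).map (fun p => (p.1.layer (l + 1) hl j).ghost)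
      = chainLaw κ D (l + 1) := by
  have hm : Measurable fun p : SuperTree M n L × W =>
      ((p.1.selected, p.2), (p.1.layer (l + 1) hl j).ghost) :=
    ((SuperTree.measurable_selected.comp measurable_fst).prodMk measurable_snd).prodMk
      (Cell.measurable_ghost.comp ((SuperTree.measurable_cell hl j).comp measurable_fst))
  have hnode : Measurable fun p : DataTree M n L × W =>
      p.1.layer l (Nat.le_of_succ_le hl) j.parent :=
    (DataTree.measurable_node (Nat.le_of_succ_le hl) _).comp measurable_fst
  have h := congrArg (Measure.map Prod.snd) (jointLaw_map_selected_ghost κ n L D A hl j)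
  rw [Measure.map_map measurable_snd hm] at h
  refine h.trans ?_
  rw [chainLaw, ← dataLaw_map_node κ n L D A (Nat.le_of_succ_le hl) j.parent]
  refine Measure.ext_of_lintegral _ fun f hf => ?_
  rw [lintegral_map hf measurable_snd,
    Measure.lintegral_compProd (f := fun a => f a.2) (hf.comp measurable_snd),
    Measure.lintegral_bind (κ l).aemeasurable hf.aemeasurable,
    lintegral_map hf.lintegral_kernel hnode]
  rfl

end MarginalLaws

variable {W : Type v} [MetricSpace W] [MeasurableSpace W]
  (A : Kernel (DataTree M n L) W) [IsMarkovKernel A]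

variable {l : ℕ} (hl : l + 1 ≤ L) (j : Pos n (l + 1)) {F : W → M (l + 1) → ℝ}

/-- The part of the truncated difference of the losses at the two candidates of a cell that stays
after replacing the hypothesis by a fixed `w₀` inside the loss. -/
noncomputable def centerTerm (F : W → M (l + 1) → ℝ) (w₀ : W) (k : ℝ) : ℝ :=
  ∫ p, cutoff k w₀ p.2 * (F w₀ (p.1.layer (l + 1) hl j).ghost
    - F w₀ (p.1.layer (l + 1) hl j).selected) ∂jointLaw κ n L D A

variable {w₀ : W} {K : ℝ≥0}

/-- Ghost and selected node have the same law, so the integral without cutoff is zero. With the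
cutoff it need not be, because the weight depends on `W`; but the weights tend to one boundedly. -/
lemma tendsto_centerTerm (hdist : Measurable fun p : W × W => dist p.1 p.2)
    (hF : Measurable fun p : W × M (l + 1) => F p.1 p.2)
    (hint : Integrable (F w₀) (chainLaw κ D (l + 1))) :
    Filter.Tendsto (fun k : ℕ => centerTerm κ n L D A hl j F w₀ ((k : ℝ) + 1)) .atTop (nhds 0) := by
  have hcell : Measurable fun p : SuperTree M n L × W => p.1.layer (l + 1) hl j :=
    (SuperTree.measurable_cell hl j).comp measurable_fst
  have hg : Measurable fun p : SuperTree M n L × W => (p.1.layer (l + 1) hl j).ghost :=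
    Cell.measurable_ghost.comp hcell
  have hs : Measurable fun p : SuperTree M n L × W => (p.1.layer (l + 1) hl j).selected :=
    Cell.measurable_selected.comp hcell
  have hF0 : Measurable (F w₀) := hF.comp measurable_prodMk_left
  have hgl := jointLaw_map_ghost κ n L D A hl j
  have hsl := jointLaw_map_selected_node κ n L D A hl j
  have hig : Integrable (fun p : SuperTree M n L × W => F w₀ (p.1.layer (l + 1) hl j).ghost)
      (jointLaw κ n L D A) := by
    rw [← hgl] at hint
    exact hint.comp_measurable hg
  have his : Integrable (fun p : SuperTree M n L × W => F w₀ (p.1.layer (l + 1) hl j).selected)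
      (jointLaw κ n L D A) := by
    rw [← hsl] at hint
    exact hint.comp_measurable hs
  have hzero : ∫ p, (F w₀ (p.1.layer (l + 1) hl j).ghost
      - F w₀ (p.1.layer (l + 1) hl j).selected) ∂jointLaw κ n L D A = 0 := by
    rw [integral_sub hig his, sub_eq_zero]
    have e1 := integral_map (μ := jointLaw κ n L D A) hg.aemeasurable
      (f := F w₀) hF0.aestronglyMeasurable
    have e2 := integral_map (μ := jointLaw κ n L D A) hs.aemeasurable
      (f := F w₀) hF0.aestronglyMeasurable
    exact e1.symm.trans (((congrArg (fun μ => ∫ x, F w₀ x ∂μ) (hgl.trans hsl.symm))).trans e2)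
  rw [← hzero]
  refine tendsto_integral_of_dominated_convergence _ (fun k => ?_) (hig.sub his).abs
    (fun k => .of_forall fun p => ?_) (.of_forall fun p => ?_)
  · exact (((measurable_cutoff hdist _ w₀).comp measurable_snd).mul
      ((hF0.comp hg).sub (hF0.comp hs))).aestronglyMeasurable
  · exact abs_cutoff_mul_le (by positivity) _ _ _
  · simpa using (tendsto_cutoff w₀ p.2).mul_const _

/-- One layer of the telescoping decomposition. -/
lemma layer_difference_eq (hdist : Measurable fun p : W × W => dist p.1 p.2)
    (hF : Measurable fun p : W × M (l + 1) => F p.1 p.2)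
    (hK : ∀ w w' x, |F w x - F w' x| ≤ K * dist w w')
    (hint : Integrable (F w₀) (chainLaw κ D (l + 1))) {k : ℝ} (hk : 0 < k) :
    ∫ p, cutoff k w₀ p.2 * ∫ y, F p.2 y ∂κ l (p.1.layer l (Nat.le_of_succ_le hl) j.parent)
        ∂dataLaw κ n L D A
      - ∫ p, cutoff k w₀ p.2 * F p.2 (p.1.layer (l + 1) hl j) ∂dataLaw κ n L D A
      = centerTerm κ n L D A hl j F w₀ k
        + ∫ p, cellGap F w₀ k (p.1.layer (l + 1) hl j) p.2 ∂jointLaw κ n L D A := by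
  have hcell : Measurable fun p : SuperTree M n L × W => p.1.layer (l + 1) hl j :=
    (SuperTree.measurable_cell hl j).comp measurable_fst
  have hg : Measurable fun p : SuperTree M n L × W => (p.1.layer (l + 1) hl j).ghost :=
    Cell.measurable_ghost.comp hcell
  have hs : Measurable fun p : SuperTree M n L × W => (p.1.layer (l + 1) hl j).selected :=
    Cell.measurable_selected.comp hcell
  have hgl := jointLaw_map_ghost κ n L D A hl j
  have hsl := jointLaw_map_selected_node κ n L D A hl j
  have hc := measurable_cutoff hdist k w₀
  -- `F w₀` is treated as a loss constant in the hypothesis, so that the same integrability lemma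
  -- covers the center terms.
  have hF0 : Measurable fun p : W × M (l + 1) => F w₀ p.2 :=
    hF.comp (measurable_const.prodMk measurable_snd)
  have hK0 : ∀ w w' x, |(fun _ : W => F w₀) w x - (fun _ : W => F w₀) w' x| ≤ K * dist w w' :=
    fun w w' x => by simpa using mul_nonneg K.coe_nonneg dist_nonneg
  have i1 := integrable_cutoff_mul (P := jointLaw κ n L D A) hdist hF hK hint hk
    measurable_snd hg hgl
  have i2 := integrable_cutoff_mul (P := jointLaw κ n L D A) hdist hF hK hint hk
    measurable_snd hs hsl
  have i3 := integrable_cutoff_mul (w₀ := w₀) (P := jointLaw κ n L D A) hdist hF0 hK0 hint hk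
    measurable_snd hg hgl
  have i4 := integrable_cutoff_mul (w₀ := w₀) (P := jointLaw κ n L D A) hdist hF0 hK0 hint hk
    measurable_snd hs hsl
  have e2 : ∫ p, cutoff k w₀ p.2 * F p.2 (p.1.layer (l + 1) hl j) ∂dataLaw κ n L D A
      = ∫ p, cutoff k w₀ p.2 * F p.2 (p.1.layer (l + 1) hl j).selected ∂jointLaw κ n L D A := by
    have hm : Measurable fun p : SuperTree M n L × W => (p.1.selected, p.2) :=
      (SuperTree.measurable_selected.comp measurable_fst).prodMk measurable_snd
    rw [← jointLaw_map_selected, integral_map hm.aemeasurable]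
    · rfl
    · exact ((hc.comp measurable_snd).mul (hF.comp (measurable_snd.prodMk
        ((DataTree.measurable_node hl j).comp measurable_fst)))).aestronglyMeasurable
  -- The mean over a fresh child becomes the value at the ghost.
  have e1 : ∫ p, cutoff k w₀ p.2 *
      ∫ y, F p.2 y ∂κ l (p.1.layer l (Nat.le_of_succ_le hl) j.parent) ∂dataLaw κ n L D A
      = ∫ p, cutoff k w₀ p.2 * F p.2 (p.1.layer (l + 1) hl j).ghost ∂jointLaw κ n L D A := by
    have hm : Measurable fun p : SuperTree M n L × W =>
        ((p.1.selected, p.2), (p.1.layer (l + 1) hl j).ghost) :=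
      ((SuperTree.measurable_selected.comp measurable_fst).prodMk measurable_snd).prodMk hg
    have hq : Measurable fun q : (DataTree M n L × W) × M (l + 1) =>
        cutoff k w₀ q.1.2 * F q.1.2 q.2 :=
      (hc.comp (measurable_snd.comp measurable_fst)).mul
        (hF.comp ((measurable_snd.comp measurable_fst).prodMk measurable_snd))
    have hi : Integrable (fun q : (DataTree M n L × W) × M (l + 1) =>
        cutoff k w₀ q.1.2 * F q.1.2 q.2) ((jointLaw κ n L D A).map
          (fun p => ((p.1.selected, p.2), (p.1.layer (l + 1) hl j).ghost))) := by
      rw [integrable_map_measure hq.aestronglyMeasurable hm.aemeasurable]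
      exact i1
    have e := integral_map (μ := jointLaw κ n L D A) hm.aemeasurable hq.aestronglyMeasurable
    rw [jointLaw_map_selected_ghost κ n L D A hl j] at hi e
    rw [← e, Measure.integral_compProd hi]
    simp only [integral_const_mul]
    rfl
  have i12 : Integrable (fun p : SuperTree M n L × W =>
      cutoff k w₀ p.2 * F p.2 (p.1.layer (l + 1) hl j).ghost
        - cutoff k w₀ p.2 * F p.2 (p.1.layer (l + 1) hl j).selected) (jointLaw κ n L D A) :=
    i1.sub i2
  rw [e1, e2, ← sub_eq_iff_eq_add', centerTerm, ← integral_sub i1 i2, ← integral_sub i12]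
  · refine integral_congr_ae (.of_forall fun p => ?_)
    simp only [cellGap]
    ring
  · simp only [mul_sub]
    exact i3.sub i4

/-- Integrals against a law given the pair only are antisymmetric in the selector. -/
lemma integral_cellGap_kernel_eq_zero (hdist : Measurable fun p : W × W => dist p.1 p.2)
    (hF : Measurable fun p : W × M (l + 1) => F p.1 p.2)
    (hK : ∀ w w' x, |F w x - F w' x| ≤ K * dist w w') {k : ℝ} (hk : 0 < k)
    (Q : Kernel (Fin 2 → M (l + 1)) W) [IsMarkovKernel Q] :
    ∫ s, ∫ w, cellGap F w₀ k (s.layer (l + 1) hl j) w ∂Q (s.layer (l + 1) hl j).1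
      ∂superLaw κ n L D = 0 := by
  have hm : Measurable fun c : Cell M (l + 1) => ∫ w, cellGap F w₀ k c w ∂Q c.1 :=
    (StronglyMeasurable.integral_kernel_prod_right' (κ := Q.comap Prod.fst measurable_fst)
      (measurable_cellGap (w₀ := w₀) hdist hF k).stronglyMeasurable).measurable
  have hpair := (SuperTree.measurable_cell (M := M) hl j).fst
  have := Measure.isProbabilityMeasure_map (μ := superLaw κ n L D) hpair.aemeasurable
  have hi : Integrable (fun c : Cell M (l + 1) => ∫ w, cellGap F w₀ k c w ∂Q c.1)
      (((superLaw κ n L D).map (fun s => (s.layer (l + 1) hl j).1)).prod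
        (uniformOn (Set.univ : Set (Fin 2)))) := by
    refine .of_bound hm.aestronglyMeasurable (((2 * K : ℝ≥0) : ℝ) * k) (.of_forall fun c => ?_)
    simpa using norm_integral_le_of_norm_le_const (μ := Q c.1)
      (f := cellGap F w₀ k c) (.of_forall (abs_cellGap_le (w₀ := w₀) hK hk c))
  refine (integral_map (SuperTree.measurable_cell hl j).aemeasurable
    hm.aestronglyMeasurable).symm.trans ?_
  rw [superLaw_map_cell, integral_prod _ hi]
  have hanti (p : Fin 2 → M (l + 1)) (w : W) :
      cellGap F w₀ k (p, 1) w = -cellGap F w₀ k (p, 0) w := by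
    simp only [cellGap, Cell.ghost, Cell.selected, sub_self, sub_zero]
    ring
  simp [integral_uniformOn_fin_two, hanti, integral_neg]

variable [StandardBorelSpace W] [Nonempty W]

instance (l : ℕ) (hl : l ≤ L) (i : Pos n l) : IsMarkovKernel (lawGivenCell κ n L D A l hl i) := by
  unfold lawGivenCell
  infer_instance

instance (l : ℕ) (hl : l ≤ L) (i : Pos n l) : IsMarkovKernel (lawGivenPair κ n L D A l hl i) := by
  unfold lawGivenPair
  infer_instance

/-- Disintegrating along the cell gives an integral against the law given the cell, from which the
vanishing integral against the law given the pair is subtracted. The scale `k` ensures integrability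
but does not enter the bound. -/
lemma ofReal_integral_cellGap_le (hdist : Measurable fun p : W × W => dist p.1 p.2)
    (hF : Measurable fun p : W × M (l + 1) => F p.1 p.2)
    (hK : ∀ w w' x, |F w x - F w' x| ≤ K * dist w w') {k : ℝ} (hk : 0 < k) :
    ENNReal.ofReal (∫ p, cellGap F w₀ k (p.1.layer (l + 1) hl j) p.2 ∂jointLaw κ n L D A)
      ≤ 2 * K * expectedWasserstein κ n L D A (l + 1) hl j := by
  have hcell := SuperTree.measurable_cell (M := M) (n := n) hl j
  have hcell' : Measurable fun p : SuperTree M n L × W => p.1.layer (l + 1) hl j :=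
    hcell.comp measurable_fst
  have hgap := measurable_cellGap (w₀ := w₀) hdist hF k
  have hb (c : Cell M (l + 1)) (P : Measure W) [IsProbabilityMeasure P] :
      |∫ w, cellGap F w₀ k c w ∂P| ≤ ((2 * K : ℝ≥0) : ℝ) * k := by
    simpa using norm_integral_le_of_norm_le_const (μ := P)
      (f := cellGap F w₀ k c) (.of_forall (abs_cellGap_le (w₀ := w₀) hK hk c))
  have hm1 : Measurable fun c : Cell M (l + 1) =>
      ∫ w, cellGap F w₀ k c w ∂lawGivenCell κ n L D A (l + 1) hl j c :=
    (StronglyMeasurable.integral_kernel_prod_right' hgap.stronglyMeasurable).measurable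
  have hm2 : Measurable fun c : Cell M (l + 1) =>
      ∫ w, cellGap F w₀ k c w ∂lawGivenPair κ n L D A (l + 1) hl j c.1 :=
    (StronglyMeasurable.integral_kernel_prod_right'
      (κ := (lawGivenPair κ n L D A (l + 1) hl j).comap Prod.fst measurable_fst)
      hgap.stronglyMeasurable).measurable
  have i1 : Integrable (fun s : SuperTree M n L => ∫ w, cellGap F w₀ k (s.layer (l + 1) hl j) w
      ∂lawGivenCell κ n L D A (l + 1) hl j (s.layer (l + 1) hl j)) (superLaw κ n L D) :=
    .of_bound (hm1.comp hcell).aestronglyMeasurable _ (.of_forall fun s => hb _ _)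
  have i2 : Integrable (fun s : SuperTree M n L => ∫ w, cellGap F w₀ k (s.layer (l + 1) hl j) w
      ∂lawGivenPair κ n L D A (l + 1) hl j (s.layer (l + 1) hl j).1) (superLaw κ n L D) :=
    .of_bound (hm2.comp hcell).aestronglyMeasurable _ (.of_forall fun s => hb _ _)
  have e : ∫ p, cellGap F w₀ k (p.1.layer (l + 1) hl j) p.2 ∂jointLaw κ n L D A
      = ∫ s, ∫ w, cellGap F w₀ k (s.layer (l + 1) hl j) w
          ∂lawGivenCell κ n L D A (l + 1) hl j (s.layer (l + 1) hl j) ∂superLaw κ n L D := by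
    have hd : ((jointLaw κ n L D A).map fun p => p.1.layer (l + 1) hl j).compProd
          (lawGivenCell κ n L D A (l + 1) hl j)
        = (jointLaw κ n L D A).map fun p => (p.1.layer (l + 1) hl j, p.2) :=
      compProd_map_condDistrib measurable_snd.aemeasurable
    have := Measure.isProbabilityMeasure_map (μ := superLaw κ n L D) hcell.aemeasurable
    rw [jointLaw_map_cell] at hd
    have hi : Integrable (fun q : Cell M (l + 1) × W => cellGap F w₀ k q.1 q.2)
        (((superLaw κ n L D).map fun s => s.layer (l + 1) hl j).compProd
          (lawGivenCell κ n L D A (l + 1) hl j)) :=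
      .of_bound hgap.aestronglyMeasurable _
        (.of_forall fun q => abs_cellGap_le (w₀ := w₀) hK hk q.1 q.2)
    refine (integral_map (hcell'.prodMk measurable_snd).aemeasurable
      hgap.aestronglyMeasurable).symm.trans ?_
    refine Eq.trans ?_ (integral_map hcell.aemeasurable hm1.aestronglyMeasurable)
    rw [← Measure.integral_compProd hi]
    exact congrArg (fun μ => ∫ q, cellGap F w₀ k q.1 q.2 ∂μ) hd.symm
  rw [← sub_zero (∫ p, _ ∂_), ← integral_cellGap_kernel_eq_zero κ n L D hl j (w₀ := w₀) hdist hF hK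
    hk (lawGivenPair κ n L D A (l + 1) hl j), e, ← integral_sub i1 i2]
  refine (ofReal_integral_le_lintegral_ofReal _ _).trans ?_
  have h2K : (2 * K : ℝ≥0∞) = ((2 * K : ℝ≥0) : ℝ≥0∞) := by push_cast; rfl
  -- Neither monotonicity nor extracting a finite constant requires the Wasserstein distance to be
  -- measurable in the cell.
  rw [h2K, expectedWasserstein, ← lintegral_const_mul' _ _ ENNReal.coe_ne_top]
  exact lintegral_mono fun s => ofReal_integral_sub_le_wasserstein _ _
    (hgap.comp measurable_prodMk_left) (abs_cellGap_le (w₀ := w₀) hK hk _)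
    (abs_cellGap_sub_le (w₀ := w₀) hK hk _)

end LayerStep

/-! ### Telescoping over layers and removal of the cutoff -/

section Averages

/-- Every node has `n (l + 1)` children, so an average over depth `l` is an average over depth `l +
1` evaluated at parents. The differences of layers can then be taken position by position. -/
lemma sum_pos_parent {n : ℕ → ℕ} {l : ℕ} (g : Pos n l → ℝ) :
    ∑ j : Pos n (l + 1), g j.parent = n (l + 1) * ∑ i : Pos n l, g i := by
  rw [← (Fin.snocEquiv fun k : Fin (l + 1) => Fin (n (k + 1))).sum_comp, Fintype.sum_prod_type]
  have h (x : Fin (n (l + 1))) (i : Pos n l) :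
      Pos.parent (n := n) (Fin.snocEquiv (fun k : Fin (l + 1) => Fin (n (k + 1))) (x, i)) = i := by
    funext k
    exact Fin.snoc_castSucc (α := fun k : Fin (l + 1) => Fin (n (k + 1))) x i k
  refine (Finset.sum_congr rfl fun x _ => Finset.sum_congr rfl fun i _ =>
    congrArg g (h x i)).trans ?_
  rw [Finset.sum_const, nsmul_eq_mul]
  simp

lemma numNodes_zero (n : ℕ → ℕ) : numNodes n 0 = 1 := rfl

lemma numNodes_succ (n : ℕ → ℕ) (l : ℕ) : numNodes n (l + 1) = numNodes n l * n (l + 1) :=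
  Finset.prod_Icc_succ_top (Nat.le_add_left 1 l) n

lemma numNodes_pos {n : ℕ → ℕ} {L : ℕ} (hn : ∀ k, 1 ≤ k → k ≤ L → 1 ≤ n k) {l : ℕ} (hl : l ≤ L) :
    0 < numNodes n l :=
  Finset.prod_pos fun k hk =>
    hn k (Finset.mem_Icc.1 hk).1 ((Finset.mem_Icc.1 hk).2.trans hl)

variable {M : ℕ → Type u} [∀ l, MeasurableSpace (M l)]
  (κ : ∀ l, Kernel (M l) (M (l + 1))) [∀ l, IsMarkovKernel (κ l)]
  (n : ℕ → ℕ) (L : ℕ) (D : M 0)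
  {W : Type v} [MetricSpace W] [MeasurableSpace W]
  (A : Kernel (DataTree M n L) W) [IsMarkovKernel A]
  (f : W → M L → ℝ) (w₀ : W) (k : ℝ)

/-- The truncated expected loss averaged over the nodes at depth `l`. -/
noncomputable def layerRisk (l : ℕ) : ℝ :=
  if hl : l ≤ L then (1 / (numNodes n l : ℝ)) * ∑ i : Pos n l,
    ∫ p, cutoff k w₀ p.2 * nodeLoss κ f l p.2 (p.1.layer l hl i) ∂dataLaw κ n L D A
  else 0

variable {f w₀ k} {K : ℝ≥0}

lemma layerRisk_sub_succ (hdist : Measurable fun p : W × W => dist p.1 p.2)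
    (hn : ∀ k, 1 ≤ k → k ≤ L → 1 ≤ n k)
    (hf : Measurable fun p : W × M L => f p.1 p.2)
    (hK : ∀ w w' x, |f w x - f w' x| ≤ K * dist w w')
    (hpop : Integrable (f w₀) (chainLaw κ D L)) (hk : 0 < k) {l : ℕ} (hl : l + 1 ≤ L) :
    layerRisk κ n L D A f w₀ k l - layerRisk κ n L D A f w₀ k (l + 1)
      = (1 / (numNodes n (l + 1) : ℝ)) * ∑ j : Pos n (l + 1),
          centerTerm κ n L D A hl j (nodeLoss κ f (l + 1)) w₀ k
        + (1 / (numNodes n (l + 1) : ℝ)) * ∑ j : Pos n (l + 1),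
          ∫ p, cellGap (nodeLoss κ f (l + 1)) w₀ k (p.1.layer (l + 1) hl j) p.2
            ∂jointLaw κ n L D A := by
  have hN : (numNodes n l : ℝ) ≠ 0 :=
    Nat.cast_ne_zero.2 (numNodes_pos hn (Nat.le_of_succ_le hl)).ne'
  have hnl : (n (l + 1) : ℝ) ≠ 0 :=
    Nat.cast_ne_zero.2 (Nat.one_le_iff_ne_zero.1 (hn _ (Nat.le_add_left 1 l) hl))
  have hpar := sum_pos_parent fun i : Pos n l => ∫ p, cutoff k w₀ p.2 *
    nodeLoss κ f l p.2 (p.1.layer l (Nat.le_of_succ_le hl) i) ∂dataLaw κ n L D A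
  have hB : layerRisk κ n L D A f w₀ k l = (1 / (numNodes n (l + 1) : ℝ)) *
      ∑ j : Pos n (l + 1), ∫ p, cutoff k w₀ p.2 *
        nodeLoss κ f l p.2 (p.1.layer l (Nat.le_of_succ_le hl) j.parent) ∂dataLaw κ n L D A := by
    rw [hpar, layerRisk, dif_pos (Nat.le_of_succ_le hl), numNodes_succ]
    push_cast
    field_simp
  rw [hB, layerRisk, dif_pos hl, ← mul_sub, ← Finset.sum_sub_distrib, ← mul_add,
    ← Finset.sum_add_distrib]
  congr 1
  refine Finset.sum_congr rfl fun j _ => ?_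
  simp only [nodeLoss_of_lt κ f (Nat.lt_of_succ_le hl)]
  exact layer_difference_eq κ n L D A hl j hdist (measurable_nodeLoss hf _)
    (abs_nodeLoss_sub_le hf hK hl) (integrable_nodeLoss_and_integral_eq hf hpop hl).1 hk

/-- The two ends of the telescope: depth zero has the single node `D`, and at depth `L` nothing
remains to be averaged. -/
lemma integral_cutoff_mul_gap_eq (hdist : Measurable fun p : W × W => dist p.1 p.2)
    (hf : Measurable fun p : W × M L => f p.1 p.2)
    (hK : ∀ w w' x, |f w x - f w' x| ≤ K * dist w w')
    (hpop : ∀ w, Integrable (f w) (chainLaw κ D L)) (hk : 0 < k) :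
    ∫ p, cutoff k w₀ p.2 * (popRisk κ D f p.2 - empRisk f p.2 p.1) ∂dataLaw κ n L D A
      = layerRisk κ n L D A f w₀ k 0 - layerRisk κ n L D A f w₀ k L := by
  have hc := measurable_cutoff hdist k w₀
  have h0 : Measurable fun p : W × M 0 => cutoff k w₀ p.1 * nodeLoss κ f 0 p.1 p.2 :=
    (hc.comp measurable_fst).mul (measurable_nodeLoss hf 0)
  have e0 : layerRisk κ n L D A f w₀ k 0
      = ∫ p, cutoff k w₀ p.2 * popRisk κ D f p.2 ∂dataLaw κ n L D A := by
    rw [layerRisk, dif_pos (Nat.zero_le L), Fintype.sum_unique, numNodes_zero, Nat.cast_one,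
      div_one, one_mul]
    have hm : Measurable fun p : DataTree M n L × W =>
        (p.2, p.1.layer 0 (Nat.zero_le L) default) :=
      measurable_snd.prodMk ((DataTree.measurable_node (Nat.zero_le L) _).comp measurable_fst)
    have hm' : Measurable fun p : DataTree M n L × W => (p.2, D) :=
      measurable_snd.prodMk measurable_const
    refine (integral_map (f := fun q : W × M 0 => cutoff k w₀ q.1 * nodeLoss κ f 0 q.1 q.2)
      hm.aemeasurable h0.aestronglyMeasurable).symm.trans ?_
    rw [dataLaw_map_root, integral_map hm'.aemeasurable h0.aestronglyMeasurable]
    simp only [nodeLoss_zero hf (hpop _)]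
  have i0 : Integrable (fun p => cutoff k w₀ p.2 * popRisk κ D f p.2) (dataLaw κ n L D A) := by
    have := integrable_cutoff_mul (P := dataLaw κ n L D A) (w₀ := w₀) hdist
      (measurable_nodeLoss hf 0) (abs_nodeLoss_sub_le hf hK (Nat.zero_le L))
      (integrable_nodeLoss_and_integral_eq hf (hpop w₀) (Nat.zero_le L)).1 hk
      measurable_snd (measurable_const (a := D)) (by
        rw [Measure.map_const, measure_univ, one_smul, chainLaw])
    simpa only [nodeLoss_zero hf (hpop _)] using this
  have iL (i : Pos n L) : Integrable
      (fun p => cutoff k w₀ p.2 * f p.2 (p.1.layer L le_rfl i)) (dataLaw κ n L D A) :=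
    integrable_cutoff_mul hdist hf hK (hpop w₀) hk measurable_snd
      ((DataTree.measurable_node le_rfl i).comp measurable_fst)
      (dataLaw_map_node κ n L D A le_rfl i)
  have eL : layerRisk κ n L D A f w₀ k L
      = ∫ p, cutoff k w₀ p.2 * empRisk f p.2 p.1 ∂dataLaw κ n L D A := by
    rw [layerRisk, dif_pos le_rfl, nodeLoss_self, ← integral_finsetSum _ fun i _ => iL i,
      ← integral_const_mul]
    refine integral_congr_ae (.of_forall fun p => ?_)
    simp only [empRisk, ← Finset.mul_sum]
    ring
  have iE : Integrable (fun p => cutoff k w₀ p.2 * empRisk f p.2 p.1) (dataLaw κ n L D A) := by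
    refine ((integrable_finsetSum Finset.univ fun i _ => iL i).const_mul
      (1 / (numNodes n L : ℝ))).congr (.of_forall fun p => ?_)
    simp only [empRisk, ← Finset.mul_sum]
    ring
  rw [e0, eL, ← integral_sub i0 iE]
  simp only [mul_sub]

variable [StandardBorelSpace W] [Nonempty W]

theorem ofReal_genError_le (hdist : Measurable fun p : W × W => dist p.1 p.2)
    (hn : ∀ k, 1 ≤ k → k ≤ L → 1 ≤ n k)
    (hf : Measurable fun p : W × M L => f p.1 p.2)
    (hK : ∀ w w' x, |f w x - f w' x| ≤ K * dist w w')
    (hpop : ∀ w, Integrable (f w) (chainLaw κ D L))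
    (hgen : Integrable (fun p : DataTree M n L × W => popRisk κ D f p.2 - empRisk f p.2 p.1)
      (dataLaw κ n L D A)) :
    ENNReal.ofReal (genError κ n L D A f)
      ≤ 2 * (K : ℝ≥0∞) * ∑ l : Fin L, ((numNodes n (l + 1) : ℝ≥0∞))⁻¹ *
          ∑ i : Pos n (l + 1), expectedWasserstein κ n L D A (l + 1) l.2 i := by
  obtain ⟨w₀⟩ := ‹Nonempty W›
  set E : ℕ → ℝ := fun k => ∫ p, cutoff ((k : ℝ) + 1) w₀ p.2 *
    (popRisk κ D f p.2 - empRisk f p.2 p.1) ∂dataLaw κ n L D A with hE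
  set R : ℕ → ℝ := fun k => ∑ l : Fin L, (1 / (numNodes n (l + 1) : ℝ)) *
    ∑ j : Pos n (l + 1), centerTerm κ n L D A l.2 j (nodeLoss κ f (l + 1)) w₀ ((k : ℝ) + 1) with hR
  set S : ℕ → ℝ := fun k => ∑ l : Fin L, (1 / (numNodes n (l + 1) : ℝ)) *
    ∑ j : Pos n (l + 1), ∫ p, cellGap (nodeLoss κ f (l + 1)) w₀ ((k : ℝ) + 1)
      (p.1.layer (l + 1) l.2 j) p.2 ∂jointLaw κ n L D A with hS
  have hpos (k : ℕ) : 0 < (k : ℝ) + 1 := by positivity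
  -- `E` is the truncated generalization error, `R` collects the center terms and `S` the cell gaps.
  -- As `E` tends to the generalization error and `R` to zero, the uniform bound on `S` passes to
  -- the limit.
  have hES (k : ℕ) : E k - R k = S k := by
    rw [sub_eq_iff_eq_add', hE, hR, hS]
    simp only
    rw [integral_cutoff_mul_gap_eq κ n L D A hdist hf hK hpop (hpos k),
      ← Finset.sum_range_sub', Finset.sum_range, ← Finset.sum_add_distrib]
    exact Finset.sum_congr rfl fun l _ =>
      layerRisk_sub_succ κ n L D A hdist hn hf hK (hpop w₀) (hpos k) l.2
  have hRlim : Filter.Tendsto R .atTop (nhds 0) := by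
    have h0 : (0 : ℝ) = ∑ l : Fin L, (1 / (numNodes n (l + 1) : ℝ)) *
        ∑ j : Pos n (l + 1), (0 : ℝ) := by simp
    rw [h0]
    refine tendsto_finsetSum _ fun l _ => Filter.Tendsto.const_mul _
      (tendsto_finsetSum _ fun j _ => ?_)
    exact tendsto_centerTerm κ n L D A l.2 j hdist (measurable_nodeLoss hf _)
      (integrable_nodeLoss_and_integral_eq hf (hpop w₀) l.2).1
  have hElim : Filter.Tendsto E .atTop (nhds (genError κ n L D A f)) := by
    refine tendsto_integral_of_dominated_convergence _ (fun k => ?_) hgen.abs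
      (fun k => .of_forall fun p => abs_cutoff_mul_le (hpos k) _ _ _) (.of_forall fun p => ?_)
    · exact (((measurable_cutoff hdist _ w₀).comp measurable_snd).aestronglyMeasurable).mul
        hgen.aestronglyMeasurable
    · simpa using (tendsto_cutoff w₀ p.2).mul_const _
  have hSlim : Filter.Tendsto S .atTop (nhds (genError κ n L D A f)) := by
    simpa only [hES, sub_zero] using hElim.sub hRlim
  refine le_of_tendsto ((ENNReal.continuous_ofReal.tendsto _).comp hSlim)
    (.of_forall fun k => ?_)
  have hsum {ι : Type} (s : Finset ι) (g : ι → ℝ) :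
      ENNReal.ofReal (∑ i ∈ s, g i) ≤ ∑ i ∈ s, ENNReal.ofReal (g i) :=
    Finset.le_sum_of_subadditive _ ENNReal.ofReal_zero.le
      (fun _ _ => ENNReal.ofReal_add_le) s g
  refine (hsum _ _).trans ?_
  rw [Finset.mul_sum]
  refine Finset.sum_le_sum fun l _ => ?_
  have hN : (0 : ℝ) < numNodes n (l + 1) := Nat.cast_pos.2 (numNodes_pos hn l.2)
  rw [one_div, ENNReal.ofReal_mul (inv_nonneg.2 hN.le), ENNReal.ofReal_inv_of_pos hN,
    ENNReal.ofReal_natCast, mul_left_comm]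
  refine mul_le_mul_right ((hsum _ _).trans ?_) _
  rw [Finset.mul_sum]
  exact Finset.sum_le_sum fun j _ => ofReal_integral_cellGap_le κ n L D A l.2 j hdist
    (measurable_nodeLoss hf _) (abs_nodeLoss_sub_le hf hK l.2) (hpos k)

lemma NodeSpace.measurable_point {Z : Type u} [MeasurableSpace Z] {h : ℕ} (e : h = 0) :
    Measurable (NodeSpace.point e : NodeSpace Z h → Z) := by
  subst e
  exact measurable_id

end Averages
end HFL

open HFL
theorem mainTheorem1
    {Z : Type*} [MeasurableSpace Z]
    {W : Type*} [MetricSpace W] [MeasurableSpace W] [StandardBorelSpace W] [Nonempty W]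
    (hdist : Measurable fun p : W × W => dist p.1 p.2)
    (L : ℕ) (n : ℕ → ℕ) (hn : ∀ k, 1 ≤ k → k ≤ L → 1 ≤ n k)
    (D : Node Z L 0)
    (A : Kernel (DataTree (Node Z L) n L) W) [IsMarkovKernel A]
    (ℓ : W → Z → ℝ) (hℓ : Measurable fun p : W × Z => ℓ p.1 p.2)
    (Lip : ℝ≥0) (hLip : ∀ w w' z, |ℓ w z - ℓ w' z| ≤ Lip * dist w w')
    (hpop : ∀ w, Integrable (fun x => ℓ w (leafPoint x)) (chainLaw (childKernel Z L) D L))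
    (hgen : Integrable
      (fun p : DataTree (Node Z L) n L × W =>
        popRisk (childKernel Z L) D (fun w x => ℓ w (leafPoint x)) p.2 -
          empRisk (fun w x => ℓ w (leafPoint x)) p.2 p.1)
      (dataLaw (childKernel Z L) n L D A)) :
    ((genError (childKernel Z L) n L D A (fun w x => ℓ w (leafPoint x)) : ℝ) : EReal) ≤
      ((2 * (Lip : ℝ≥0∞) * ∑ l : Fin L, ((numNodes n (l + 1) : ℝ≥0∞))⁻¹ *
          ∑ i : Pos n (l + 1),
            expectedWasserstein (childKernel Z L) n L D A (l + 1) l.2 i : ℝ≥0∞) : EReal) := by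
  have hf : Measurable fun p : W × Node Z L L => ℓ p.1 (leafPoint p.2) :=
    hℓ.comp (measurable_fst.prodMk
      ((NodeSpace.measurable_point (Nat.sub_self L)).comp measurable_snd))
  have h := ofReal_genError_le (childKernel Z L) n L D A hdist hn hf
    (fun w w' x => hLip w w' (leafPoint x)) hpop hgen
  refine le_trans ?_ (EReal.coe_ennreal_le_coe_ennreal_iff.2 h)
  -- `ENNReal.ofReal` truncates at zero, which loses nothing: the error is at most its positive
  -- part.
  rw [EReal.coe_ennreal_ofReal]
  exact_mod_cast le_max_left _ _
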